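/- The standard cycle form of a permutation $\pi$ of $[N]=\{1,\dots,N\}$ writes $\pi$ as a product of cycles (fixed points included), each cycle starting with its smallest element, the cycles being listed in decreasing order of their smallest elements. A cyclic occurrence of the pattern 2--13 in $\pi$ is a choice of an entry $u$ and of two consecutive entries $v,w$ (in this order) of one cycle word $c^{b}$ of the standard cycle form, with $v<u<w$, such that $u$ lies either in a cycle word listed before $c^{b}$ (between cycles) or in $c^{b}$ itself to the left of $v$ (within a cycle). For integers $i,m,n\ge 0$ let $\Phi_{i,m}(n)$ be the number of permutations of $[n+1]$ with exactly $i$ cyclic occurrences of 2--13 and exactly $m+1$ cycles. With the convention $\binom{a}{b}=0$ for $b<0$: **Theorem.** For all integers $n,m\ge 0$, $$\Phi_{0,m}(n)=\binom{2n-m}{n-m}\frac{m+1}{n+1},$$ $$\Phi_{1,m}(n)=\binom{2n-m}{n-m-1}\frac{(m+1)n^2+3(m-1)n+m^2+9m+2}{(n+2)(n+3)};$$ for all $n\ge 0$ and $m\ge 1$, $$\Phi_{2,m}(n)=\binom{2n-m}{n-m-1}\frac{1}{2(n+2)(n+3)(n+4)}\Big((m+1)n^4-(6-5m+m^2)n^3-(29-32m+3m^2)n^2-(66-72m+12m^2+2m^3)n-20+54m-28m^2-6m^3\Big);$$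 and for all $n\ge 0$, $$\Phi_{2,0}(n)=\frac n2\binom{2n}{n-4}.$$ -/

import Mathlib

/-- The word `c, π c, π (π c), …` listing the cycle of `π` through `c` once, starting with `c`. -/
def cycleWord {n : ℕ} (π : Equiv.Perm (Fin n)) (c : Fin n) : List (Fin n) :=
  List.iterate π c (Finset.univ.filter fun x => π.SameCycle c x).card

/-- The standard cycle form of `π`: every cycle (fixed points included) is written starting with
its smallest element, and the cycles are listed by decreasing smallest element. -/
def standardCycleForm {n : ℕ} (π : Equiv.Perm (Fin n)) : List (List (Fin n)) :=
  ((Finset.univ.filter fun c => ∀ x, π.SameCycle c x → c ≤ x).sort (fun a b => b ≤ a)).map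
    (cycleWord π)

/-- The number of cycles of `π`, fixed points included. -/
def numCycles {n : ℕ} (π : Equiv.Perm (Fin n)) : ℕ :=
  (standardCycleForm π).length

/-- A position in the standard cycle form: a cycle `p.1` and a place `p.2` in that cycle. -/
abbrev CyclePos {n : ℕ} (π : Equiv.Perm (Fin n)) : Type :=
  (a : Fin (standardCycleForm π).length) × Fin ((standardCycleForm π).get a).length

/-- The element standing at a given position of the standard cycle form. -/
def letterAt {n : ℕ} (π : Equiv.Perm (Fin n)) (p : CyclePos π) : Fin n :=
  ((standardCycleForm π).get p.1).get p.2

/-- Occurrences `(p, q, r)` of 2–13 between cycles: the letters at `p, q, r` play the roles of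
`2, 1, 3`, the letters `1, 3` are adjacent in one cycle, and `2` is in an earlier cycle.
(Hence `2` precedes `13`, and `13` is adjacent, in the concatenation of all cycles.) -/
def occBetween {n : ℕ} (π : Equiv.Perm (Fin n)) :
    Finset (CyclePos π × CyclePos π × CyclePos π) :=
  Finset.univ.filter fun (p, q, r) =>
    q.1 = r.1 ∧ (q.2 : ℕ) + 1 = (r.2 : ℕ) ∧
    letterAt π q < letterAt π p ∧ letterAt π p < letterAt π r ∧
    p.1 < q.1

/-- Occurrences `(p, q, r)` of 2–13 within a cycle: the letters at `p, q, r` play the roles of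
`2, 1, 3`, all are in the same cycle word, `1, 3` are adjacent there, and `2` precedes them. -/
def occWithin {n : ℕ} (π : Equiv.Perm (Fin n)) :
    Finset (CyclePos π × CyclePos π × CyclePos π) :=
  Finset.univ.filter fun (p, q, r) =>
    q.1 = r.1 ∧ (q.2 : ℕ) + 1 = (r.2 : ℕ) ∧
    letterAt π q < letterAt π p ∧ letterAt π p < letterAt π r ∧
    p.1 = q.1 ∧ (p.2 : ℕ) < (q.2 : ℕ)

/-- The number of cyclic occurrences of 2–13 in `π`. -/
def cyclicOcc {n : ℕ} (π : Equiv.Perm (Fin n)) : ℕ :=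
  (occBetween π).card + (occWithin π).card

/-- The number of permutations of length `n` with `i` cyclic occurrences of 2–13 and
`j` cycles. -/
def numPerms (i j n : ℕ) : ℕ :=
  (Finset.univ.filter fun π : Equiv.Perm (Fin n) => cyclicOcc π = i ∧ numCycles π = j).card

/-- The binomial coefficient `a (a - 1) ⋯ (a - b + 1) / b!` for integers `a`, `b`, equal to `0`
when `b` is negative. -/
def intBinom (a b : ℤ) : ℤ :=
  if b < 0 then 0 else Ring.choose a b.toNat

/-! Erase the parentheses of the standard cycle form. Each cycle starts with a letter smaller than
everything before it, so the adjacencies between consecutive cycles are descents and carry no 13,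
and the cycles start exactly at the left-to-right minima. Cyclic occurrences of 2–13 thus become
ordinary ones (`listOcc_cycleLetters`), cycles become left-to-right minima
(`minimaBelow_cycleLetters`), and the word determines the permutation (`cycleLetters_injective`).

Words are built by inserting the letters from the largest to the smallest, through tuples of blocks.
A new smallest letter forms a block, extends a block at one end, or joins two neighbours. Each block
to its right will later be preceded by something smaller, which yields one 13 around the new letter;
so an insertion with j blocks to its right costs q^j. A separator 0 before each block makes these
occurrences visible at once. This gives the recurrences of `closedWeight` and `openWeight`, the
latter also recording the minima of the first block, and `sum_perm_eq_openWeight`.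

Let X mark letters, T = X(1+T)^2, s = X(1+T) and J = 1/(1-T). Up to order q^2, the series for g
blocks is T^g times a polynomial in g, and m+1 minima contribute s^(m+1). Deviations occur only for
small g, where the geometric sum in q is too short. One of them affects single blocks exactly when m
= 0, whence the separate formula for two occurrences in one cycle. The guessed series satisfy the
recurrences, so they are the right ones (`coeff_closedPoly_two`, `coeff_openPoly_two` and their
lower-order companions).

The coefficients of s^(m+1) J T^i are binomials (`coeff_s_pow_mul`), and J^2, J^3 enter only through
X d/dX of s^(m+1) J. Neighbouring binomials have rational ratios, so each answer collapses to a
single binomial. -/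

/-- The number of adjacent pairs `v, w` in a list with `v < u < w`. -/
def straddleCount {α : Type*} [LinearOrder α] (u : α) : List α → ℕ
  | [] => 0
  | [_] => 0
  | v :: w :: l => (if v < u ∧ u < w then 1 else 0) + straddleCount u (w :: l)

/-- The number of occurrences of 2–13 in a list. -/
def listOcc {α : Type*} [LinearOrder α] : List α → ℕ
  | [] => 0
  | u :: l => straddleCount u l + listOcc l

/-- The number of left-to-right minima of a list that are smaller than `b`. -/
def minimaBelow {α : Type*} [LinearOrder α] : α → List α → ℕ
  | _, [] => 0
  | b, x :: l => if x < b then minimaBelow x l + 1 else minimaBelow b l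

/-! ### Occurrences of 2–13 under insertion of a new smallest letter. -/

section Words

theorem straddleCount_zero (l : List ℕ) : straddleCount 0 l = 0 := by
  induction l with
  | nil => rfl
  | cons v l ih => cases l with
    | nil => rfl
    | cons w l => simp [straddleCount, ih]

theorem straddleCount_eq_zero_of_le {α : Type*} [LinearOrder α] {a : α} {l : List α}
    (h : ∀ x ∈ l, a ≤ x) : straddleCount a l = 0 := by
  induction l with
  | nil => rfl
  | cons v l ih => cases l with
    | nil => rfl
    | cons w l =>
      have hv := h v (by simp)
      rw [straddleCount, ih (fun x hx => h x (by simp [hx])), if_neg]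
      intro h'
      exact absurd h'.1 (not_lt.2 hv)

theorem straddleCount_dedup_zero (u : ℕ) (X Y : List ℕ) :
    straddleCount u (X ++ 0 :: 0 :: Y) = straddleCount u (X ++ 0 :: Y) := by
  induction X with
  | nil => simp [straddleCount]
  | cons x X ih => cases X with
    | nil => simp [straddleCount]
    | cons y X => simpa [straddleCount] using ih

theorem straddleCount_append_zero (u : ℕ) (X : List ℕ) :
    straddleCount u (X ++ [0]) = straddleCount u X := by
  induction X with
  | nil => simp [straddleCount]
  | cons x X ih => cases X with
    | nil => simp [straddleCount]
    | cons y X => simpa [straddleCount] using ih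

theorem listOcc_dedup_zero (X Y : List ℕ) :
    listOcc (X ++ 0 :: 0 :: Y) = listOcc (X ++ 0 :: Y) := by
  induction X with
  | nil => simp [listOcc, straddleCount_zero]
  | cons x X ih =>
    simp only [List.cons_append, listOcc, ih, straddleCount_dedup_zero]

theorem listOcc_append_zero (X : List ℕ) : listOcc (X ++ [0]) = listOcc X := by
  induction X with
  | nil => simp [listOcc, straddleCount_zero]
  | cons x X ih =>
    simp only [List.cons_append, listOcc, ih, straddleCount_append_zero]

theorem straddleCount_replace_min {a u : ℕ} (hu : u = 0 ∨ a < u) {X Y : List ℕ}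
    (hX : ∀ x ∈ X, x = 0 ∨ a < x) :
    straddleCount u (X ++ a :: Y) = straddleCount u (X ++ 0 :: Y) := by
  induction X with
  | nil =>
    cases Y with
    | nil => rfl
    | cons y Y =>
      simp only [List.nil_append, straddleCount]
      congr 2
      simp only [eq_iff_iff, and_congr_left_iff]
      omega
  | cons x X ih =>
    have ih' := ih fun z hz => hX z (by simp [hz])
    cases X with
    | nil =>
      simp only [List.cons_append, List.nil_append, straddleCount] at ih' ⊢
      rw [ih', if_neg (by omega), if_neg (by omega)]
    | cons y X =>
      simp only [List.cons_append, straddleCount] at ih' ⊢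
      rw [ih']

/-- Letters on the left are 0, which never plays the 2, or exceed `a`. As a possible 1 or 3 for
them, `a` is indistinguishable from 0. What is lost is exactly the occurrences in which `a` itself
is the 2. -/
theorem listOcc_replace_min {a : ℕ} {X Y : List ℕ} (hX : ∀ x ∈ X, x = 0 ∨ a < x) :
    listOcc (X ++ a :: Y) = listOcc (X ++ 0 :: Y) + straddleCount a Y := by
  induction X with
  | nil => simp [listOcc, straddleCount_zero, add_comm]
  | cons x X ih =>
    have ih' := ih fun z hz => hX z (by simp [hz])
    have h := straddleCount_replace_min (hX x (by simp)) (X := X) (Y := Y)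
      fun z hz => hX z (by simp [hz])
    simp only [List.cons_append, listOcc, ih', h]
    ring

/-- The letter `a` undercuts all of `A`, and nothing after it goes lower. -/
theorem minimaBelow_insert_min {α : Type*} [LinearOrder α] {a b : α} (hab : a < b) {A B : List α}
    (hA : ∀ x ∈ A, a < x) (hB : ∀ x ∈ B, a < x) :
    minimaBelow b (A ++ a :: B) = minimaBelow b A + 1 := by
  induction A generalizing b with
  | nil =>
    have : ∀ l : List α, (∀ x ∈ l, a < x) → minimaBelow a l = 0 := by
      intro l
      induction l with
      | nil => intro; rfl
      | cons x l ih =>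
        intro h
        rw [minimaBelow, if_neg (not_lt.2 (h x (by simp)).le), ih fun z hz => h z (by simp [hz])]
    simp [minimaBelow, hab, this B hB]
  | cons x A ih =>
    have ih' := fun b (hb : a < b) => ih hb fun z hz => hA z (by simp [hz])
    simp only [List.cons_append, minimaBelow]
    split_ifs with h
    · rw [ih' x (hA x (by simp))]
    · rw [ih' b hab]

/-- The word obtained from a tuple of lists by writing a separator `0` before each list. -/
def separatedWord (T : List (List ℕ)) : List ℕ := T.flatMap fun L => 0 :: L

/-- The number of occurrences of 2–13 in the separated word of a tuple. -/
def tupleOcc (T : List (List ℕ)) : ℕ := listOcc (separatedWord T)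

/-- The number of left-to-right minima below `b` of the first list of a tuple. -/
def headMinima (b : ℕ) : List (List ℕ) → ℕ
  | [] => 0
  | L :: _ => minimaBelow b L

/-- All lists of the tuple are nonempty, with letters greater than `a`. -/
def TupleAbove (a : ℕ) (T : List (List ℕ)) : Prop :=
  ∀ L ∈ T, L ≠ [] ∧ ∀ x ∈ L, a < x

@[simp] theorem separatedWord_nil : separatedWord [] = [] := rfl

@[simp] theorem separatedWord_cons (L T) :
    separatedWord (L :: T) = 0 :: (L ++ separatedWord T) := rfl

@[simp] theorem separatedWord_append (S T) :
    separatedWord (S ++ T) = separatedWord S ++ separatedWord T := by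
  simp [separatedWord]

theorem TupleAbove.mem_separatedWord {a : ℕ} {T : List (List ℕ)} (hT : TupleAbove a T) {x : ℕ}
    (hx : x ∈ separatedWord T) : x = 0 ∨ a < x := by
  simp only [separatedWord, List.mem_flatMap, List.mem_cons] at hx
  obtain ⟨L, hL, rfl | hx⟩ := hx
  · exact Or.inl rfl
  · exact Or.inr ((hT L hL).2 x hx)

/-- Within blocks all letters exceed `a`, and a step into a separator goes down. Only the step from
a separator to the first letter of its (nonempty) block straddles `a`. -/
theorem TupleAbove.straddleCount_append_separatedWord {a : ℕ} (ha : 0 < a) {B : List ℕ}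
    (hB : ∀ x ∈ B, a < x) {Q : List (List ℕ)} (hQ : TupleAbove a Q) :
    straddleCount a (B ++ separatedWord Q) = Q.length := by
  induction Q generalizing B with
  | nil =>
    simpa using straddleCount_eq_zero_of_le fun x hx => (hB x hx).le
  | cons L Q ih =>
    have ih' := ih (B := L) (fun x hx => (hQ L (by simp)).2 x hx)
      (fun M hM => hQ M (by simp [hM]))
    have h0 : straddleCount a (0 :: (L ++ separatedWord Q)) = Q.length + 1 := by
      obtain ⟨hne, hL⟩ := hQ L (by simp)
      cases L with
      | nil => exact absurd rfl hne
      | cons x L =>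
        rw [List.cons_append] at ih' ⊢
        rw [straddleCount, ih', if_pos ⟨ha, hL x (by simp)⟩, add_comm]
    simp only [separatedWord_cons, List.length_cons]
    clear ih ih'
    induction B with
    | nil => exact h0
    | cons y B ihB =>
      have := ihB fun x hx => hB x (by simp [hx])
      cases B with
      | nil => simpa [straddleCount] using this
      | cons z B =>
        rw [List.cons_append, List.cons_append] at *
        rw [straddleCount, this, if_neg (by have := hB y (by simp); omega), zero_add]

theorem listOcc_append_zero_separatedWord (X : List ℕ) (Q : List (List ℕ)) :
    listOcc (X ++ 0 :: separatedWord Q) = listOcc (X ++ separatedWord Q) := by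
  cases Q with
  | nil => simpa using listOcc_append_zero X
  | cons L Q => simpa using listOcc_dedup_zero X (L ++ separatedWord Q)

/-- Turning `a` into a separator costs one occurrence per block on the right. The four kinds of
insertion are the cases of `A`, `B` empty or not; an empty side leaves a redundant 0, which does not
affect the count. -/
theorem tupleOcc_insert {a : ℕ} (ha : 0 < a) {P Q : List (List ℕ)} {A B : List ℕ}
    (hP : TupleAbove a P) (hQ : TupleAbove a Q) (hA : ∀ x ∈ A, a < x) (hB : ∀ x ∈ B, a < x) :
    tupleOcc (P ++ (A ++ a :: B) :: Q) =
      listOcc (separatedWord P ++ 0 :: A ++ 0 :: (B ++ separatedWord Q)) + Q.length := by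
  rw [← hQ.straddleCount_append_separatedWord ha hB, ← listOcc_replace_min]
  · simp [tupleOcc]
  · intro x hx
    simp only [List.mem_append, List.mem_cons] at hx
    rcases hx with hx | rfl | hx
    · exact hP.mem_separatedWord hx
    · exact Or.inl rfl
    · exact Or.inr (hA x hx)

variable {a : ℕ} {P Q : List (List ℕ)} {L M : List ℕ}

theorem tupleOcc_insert_new (ha : 0 < a) (hP : TupleAbove a P) (hQ : TupleAbove a Q) :
    tupleOcc (P ++ [a] :: Q) = tupleOcc (P ++ Q) + Q.length := by
  have h := tupleOcc_insert ha hP hQ (A := []) (B := []) (by simp) (by simp)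
  simp only [List.nil_append] at h
  rw [h]
  have h2 := listOcc_dedup_zero (separatedWord P) (separatedWord Q)
  simp only [List.append_assoc, List.singleton_append] at *
  simp [h2, tupleOcc, listOcc_append_zero_separatedWord]

theorem tupleOcc_insert_front (ha : 0 < a) (hP : TupleAbove a P) (hQ : TupleAbove a (L :: Q)) :
    tupleOcc (P ++ (a :: L) :: Q) = tupleOcc (P ++ L :: Q) + Q.length := by
  have h := tupleOcc_insert ha hP (fun M hM => hQ M (by simp [hM]) : TupleAbove a Q)
    (A := []) (B := L) (by simp) (hQ L (by simp)).2
  simp only [List.nil_append] at h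
  rw [h]
  have h2 := listOcc_dedup_zero (separatedWord P) (L ++ separatedWord Q)
  simp only [List.append_assoc, List.singleton_append] at *
  simp [h2, tupleOcc]

theorem tupleOcc_insert_back (ha : 0 < a) (hP : TupleAbove a P) (hQ : TupleAbove a (L :: Q)) :
    tupleOcc (P ++ (L ++ [a]) :: Q) = tupleOcc (P ++ L :: Q) + Q.length := by
  rw [tupleOcc_insert ha hP (fun M hM => hQ M (by simp [hM]) : TupleAbove a Q)
    (A := L) (B := []) (hQ L (by simp)).2 (by simp)]
  rw [List.nil_append, listOcc_append_zero_separatedWord]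
  simp [tupleOcc]

theorem tupleOcc_insert_join (ha : 0 < a) (hP : TupleAbove a P)
    (hQ : TupleAbove a (L :: M :: Q)) :
    tupleOcc (P ++ (L ++ a :: M) :: Q) = tupleOcc (P ++ L :: M :: Q) + Q.length := by
  rw [tupleOcc_insert ha hP (fun N hN => hQ N (by simp [hN]) : TupleAbove a Q)
    (A := L) (B := M) (hQ L (by simp)).2 (hQ M (by simp)).2]
  simp [tupleOcc]

end Words

/-! ### Generating all tuples of blocks by insertion. -/

/-- All tuples obtained from a tuple of lists by inserting the letter `a`: as a new list, at
one end of a list, or joining two neighbouring lists. -/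
def insertLetter (a : ℕ) : List (List ℕ) → List (List (List ℕ))
  | [] => [[[a]]]
  | L :: Q =>
    ([a] :: L :: Q) :: ((a :: L) :: Q) :: ((L ++ [a]) :: Q) ::
      ((match Q with
        | [] => []
        | M :: R => [(L ++ a :: M) :: R]) ++ (insertLetter a Q).map (L :: ·))

/-- All tuples of nonempty lists that together contain each of the given letters once. -/
def tuplesOn : List ℕ → List (List (List ℕ))
  | [] => [[]]
  | a :: S => (tuplesOn S).flatMap (insertLetter a)

theorem insertLetter_cons (a : ℕ) (L : List ℕ) (Q : List (List ℕ)) :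
    insertLetter a (L :: Q) = ([a] :: L :: Q) :: ((a :: L) :: Q) :: ((L ++ [a]) :: Q) ::
      ((match Q with
        | [] => []
        | M :: R => [(L ++ a :: M) :: R]) ++ (insertLetter a Q).map (L :: ·)) := by
  cases Q <;> rfl

theorem mem_insertLetter_cons_of_mem {a : ℕ} {L : List ℕ} {Q K : List (List ℕ)}
    (h : K ∈ insertLetter a Q) : L :: K ∈ insertLetter a (L :: Q) := by
  rw [insertLetter_cons]
  simp only [List.mem_cons, List.mem_append, List.mem_map]
  exact Or.inr <| Or.inr <| Or.inr <| Or.inr ⟨_, h, rfl⟩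

theorem sum_map_flatMap {α β M : Type*} [AddMonoid M] (f : β → M) (g : α → List β) (l : List α) :
    ((l.flatMap g).map f).sum = (l.map fun x => ((g x).map f).sum).sum := by
  induction l with
  | nil => rfl
  | cons x l ih => simp [ih]

theorem TupleAbove.tail {a : ℕ} {L : List ℕ} {T : List (List ℕ)} (h : TupleAbove a (L :: T)) :
    TupleAbove a T := fun M hM => h M (by simp [hM])

theorem TupleAbove.mono {a b : ℕ} (hab : b ≤ a) {T : List (List ℕ)} (h : TupleAbove a T) :
    TupleAbove b T := fun L hL => ⟨(h L hL).1, fun x hx => hab.trans_lt ((h L hL).2 x hx)⟩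

theorem TupleAbove.append_singleton {a : ℕ} {L : List ℕ} {P Q : List (List ℕ)}
    (hP : TupleAbove a P) (hQ : TupleAbove a (L :: Q)) : TupleAbove a (P ++ [L]) := by
  intro M hM
  rcases List.mem_append.1 hM with h | h
  · exact hP M h
  · exact hQ M (by simp_all)

theorem length_pos_of_mem_insertLetter {a : ℕ} {T K : List (List ℕ)} (h : K ∈ insertLetter a T) :
    0 < K.length := by
  cases T with
  | nil => simp_all [insertLetter]
  | cons L Q =>
    rcases Q with _ | ⟨M, Q⟩ <;> simp [insertLetter] at h <;> aesop

theorem TupleAbove.insertLetter {a b : ℕ} (hb : b < a) {T K : List (List ℕ)}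
    (hT : TupleAbove a T) (h : K ∈ insertLetter a T) : TupleAbove b K := by
  induction T generalizing K with
  | nil =>
    simp only [_root_.insertLetter, List.mem_singleton] at h
    subst h
    intro L hL
    simp_all
  | cons L Q ih =>
    have hL := hT.mono hb.le L (by simp)
    have hQ : TupleAbove b Q := hT.tail.mono hb.le
    have hcons : ∀ {M : List ℕ} {R : List (List ℕ)}, (M ≠ [] ∧ ∀ x ∈ M, b < x) → TupleAbove b R →
        TupleAbove b (M :: R) := by
      intro M R hM hR N hN
      rcases List.mem_cons.1 hN with rfl | hN
      · exact hM
      · exact hR N hN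
    simp only [_root_.insertLetter, List.mem_cons, List.mem_append, List.mem_map] at h
    rcases h with rfl | rfl | rfl | h | ⟨K, hK, rfl⟩
    · exact hcons (by simpa using hb) (hcons hL hQ)
    · exact hcons (by simpa using ⟨hb, hL.2⟩) hQ
    · refine hcons ⟨by simp, fun x hx => ?_⟩ hQ
      rcases List.mem_append.1 hx with h | h
      · exact hL.2 x h
      · simp_all
    · cases Q with
      | nil => simp at h
      | cons M R =>
        simp only [List.mem_singleton] at h
        subst h
        refine hcons ⟨by simp, fun x hx => ?_⟩ hQ.tail
        rcases List.mem_append.1 hx with h | h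
        · exact hL.2 x h
        · rcases List.mem_cons.1 h with rfl | h
          · exact hb
          · exact (hQ M (by simp)).2 x h
    · exact hcons hL (ih hT.tail hK)

theorem tupleAbove_of_mem_tuplesOn {b : ℕ} {S : List ℕ} (hS : (b :: S).Pairwise (· < ·))
    {T : List (List ℕ)} (hT : T ∈ tuplesOn S) : TupleAbove b T := by
  induction S generalizing b T with
  | nil =>
    simp only [tuplesOn, List.mem_singleton] at hT
    subst hT
    intro L hL
    simp at hL
  | cons a S ih =>
    simp only [tuplesOn, List.mem_flatMap] at hT
    obtain ⟨T', hT', hT⟩ := hT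
    exact (ih hS.tail hT').insertLetter (List.rel_of_pairwise_cons hS (by simp)) hT

section Mem

variable (a : ℕ) (P Q : List (List ℕ)) (L M : List ℕ)

theorem mem_insertLetter_new : P ++ [a] :: Q ∈ insertLetter a (P ++ Q) := by
  induction P with
  | nil => cases Q <;> simp [insertLetter]
  | cons N P ih =>
    exact mem_insertLetter_cons_of_mem ih

theorem mem_insertLetter_front : P ++ (a :: L) :: Q ∈ insertLetter a (P ++ L :: Q) := by
  induction P with
  | nil => simp [insertLetter]
  | cons N P ih =>
    exact mem_insertLetter_cons_of_mem ih

theorem mem_insertLetter_back : P ++ (L ++ [a]) :: Q ∈ insertLetter a (P ++ L :: Q) := by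
  induction P with
  | nil => simp [insertLetter]
  | cons N P ih =>
    exact mem_insertLetter_cons_of_mem ih

theorem mem_insertLetter_join :
    P ++ (L ++ a :: M) :: Q ∈ insertLetter a (P ++ L :: M :: Q) := by
  induction P with
  | nil => simp [insertLetter]
  | cons N P ih =>
    exact mem_insertLetter_cons_of_mem ih

end Mem

/-- Deleting `a` undoes an insertion, whose kind is read off from whether `a` has letters to its
left and to its right in its block. -/
theorem mem_tuplesOn {S : List ℕ} {T : List (List ℕ)} (hT : [] ∉ T) (h : T.flatten.Perm S) :
    T ∈ tuplesOn S := by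
  induction S generalizing T with
  | nil =>
    have h0 := List.flatten_eq_nil_iff.1 h.eq_nil
    cases T with
    | nil => simp [tuplesOn]
    | cons L T => exact absurd (by simp [h0 L (by simp)]) hT
  | cons a S ih =>
    obtain ⟨L, hL, haL⟩ := List.mem_flatten.1 (h.mem_iff.2 (List.mem_cons_self (a := a)))
    obtain ⟨P, Q, rfl⟩ := List.append_of_mem hL
    obtain ⟨A, B, rfl⟩ := List.append_of_mem haL
    simp only [List.mem_append, List.mem_cons, not_or] at hT
    obtain ⟨hP, -, hQ⟩ := hT
    have h' : (P.flatten ++ (A ++ (B ++ Q.flatten))).Perm S := by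
      rw [← List.perm_cons a]
      refine List.Perm.trans ?_ h
      simp only [List.flatten_append, List.flatten_cons]
      rw [← List.append_assoc]
      refine List.perm_middle.symm.trans ?_
      simp
    simp only [tuplesOn, List.mem_flatMap]
    by_cases hA : A = [] <;> by_cases hB : B = []
    · subst hA hB
      exact ⟨P ++ Q, ih (by simp_all) (by simpa using h'), mem_insertLetter_new a P Q⟩
    · subst hA
      exact ⟨P ++ B :: Q, ih (by simp_all [eq_comm]) (by simpa using h'),
        mem_insertLetter_front a P Q B⟩
    · subst hB
      exact ⟨P ++ A :: Q, ih (by simp_all [eq_comm]) (by simpa using h'),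
        mem_insertLetter_back a P Q A⟩
    · exact ⟨P ++ A :: B :: Q, ih (by simp_all [eq_comm]) (by simpa using h'),
        mem_insertLetter_join a P Q A B⟩

/-! ### Weight recurrences for tuples of blocks. -/

section Sums

variable {A : Type*} [CommSemiring A] (q y : A)

/-- Generating function of the tuples of `g` nonempty lists on `k` letters by the number of
occurrences of 2–13. -/
def closedWeight : ℕ → ℕ → A
  | 0, g => if g = 0 then 1 else 0
  | _ + 1, 0 => 0
  | k + 1, g + 1 => (∑ j ∈ Finset.range (g + 1), q ^ j) *
      (closedWeight k g + 2 * closedWeight k (g + 1) + closedWeight k (g + 2))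

/-- Generating function of the tuples of `g` nonempty lists on `k` letters by the number of
occurrences of 2–13 and the number of left-to-right minima of the first list. -/
def openWeight : ℕ → ℕ → A
  | 0, g => if g = 0 then 1 else 0
  | _ + 1, 0 => 0
  | k + 1, g + 1 => (∑ j ∈ Finset.range g, q ^ j) *
      (openWeight k g + 2 * openWeight k (g + 1) + openWeight k (g + 2)) +
      y * q ^ g * (closedWeight q k g + closedWeight q k (g + 1) +
        openWeight k (g + 1) + openWeight k (g + 2))

/-- Among results with `n` blocks, the block containing `a` can have any j < n blocks on its right,
once for each kind of insertion (twice for extending a block). The prefix `P` serves the induction: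
insertions beyond the first block are insertions into the tail, with that block moved to the prefix.
-/
theorem sum_insertLetter_closed {a : ℕ} (ha : 0 < a) {T : List (List ℕ)} (n : ℕ)
    (P : List (List ℕ)) (hP : TupleAbove a P) (hT : TupleAbove a T) :
    ((insertLetter a T).map fun K =>
        if K.length = n then q ^ tupleOcc (P ++ K) else 0).sum =
      q ^ tupleOcc (P ++ T) * (∑ j ∈ Finset.range n, q ^ j) *
        ((if T.length + 1 = n then 1 else 0) + 2 * (if T.length = n then 1 else 0) +
          (if T.length = n + 1 then 1 else 0)) := by
  induction T generalizing P n with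
  | nil =>
    have h := tupleOcc_insert_new ha hP (Q := []) (by intro L hL; simp at hL)
    simp only [insertLetter, List.map_cons, List.map_nil, List.sum_cons, List.sum_nil,
      List.length_cons, List.length_nil, h]
    rcases n with _ | _ | n
    · simp
    · simp
    · simp
  | cons L Q ih =>
    cases n with
    | zero =>
      rw [Finset.range_zero, Finset.sum_empty, mul_zero, zero_mul]
      refine List.sum_eq_zero fun x hx => ?_
      obtain ⟨K, hK, rfl⟩ := List.mem_map.1 hx
      rw [if_neg (length_pos_of_mem_insertLetter hK).ne']
    | succ n =>
      have h1 := tupleOcc_insert_new ha hP hT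
      have h2 := tupleOcc_insert_front ha hP hT
      have h3 := tupleOcc_insert_back ha hP hT
      have ih' := ih n (P ++ [L]) (hP.append_singleton hT) hT.tail
      simp only [List.append_assoc, List.singleton_append] at ih'
      have h4 : (((match Q with
          | [] => []
          | M :: R => [(L ++ a :: M) :: R]).map fun K : List (List ℕ) =>
            if K.length = n + 1 then q ^ tupleOcc (P ++ K) else 0).sum : A) =
          if Q.length = n + 1 then q ^ (tupleOcc (P ++ L :: Q) + n) else 0 := by
        cases Q with
        | nil => simp
        | cons M R =>
          simp only [List.map_cons, List.map_nil, List.sum_cons, List.sum_nil, List.length_cons,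
            tupleOcc_insert_join ha hP hT, add_zero, add_left_inj]
          split_ifs with h
          · rw [h]
          · rfl
      simp only [insertLetter, List.map_cons, List.sum_cons, List.map_append, List.sum_append,
        List.map_map, h4, Function.comp_def, List.length_cons, add_left_inj, ih', h1, h2, h3]
      have e1 : (if Q.length + 1 = n then q ^ (tupleOcc (P ++ L :: Q) + (Q.length + 1)) else 0 : A)
          = q ^ tupleOcc (P ++ L :: Q) * q ^ n * if Q.length + 1 = n then 1 else 0 := by
        split_ifs with h
        · rw [h, pow_add, mul_one]
        · rw [mul_zero]
      have e2 : (if Q.length = n then q ^ (tupleOcc (P ++ L :: Q) + Q.length) else 0 : A)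
          = q ^ tupleOcc (P ++ L :: Q) * q ^ n * if Q.length = n then 1 else 0 := by
        split_ifs with h
        · rw [h, pow_add, mul_one]
        · rw [mul_zero]
      have e3 : (if Q.length = n + 1 then q ^ (tupleOcc (P ++ L :: Q) + n) else 0 : A)
          = q ^ tupleOcc (P ++ L :: Q) * q ^ n * if Q.length = n + 1 then 1 else 0 := by
        split_ifs with h
        · rw [pow_add, mul_one]
        · rw [mul_zero]
      rw [e1, e2, e3, Finset.sum_range_succ]
      ring

/-- Insertions beyond the first block have j < g blocks on the right and keep its minima. Insertions
into the first position have all g: a new block or a front letter leaves `a` as the only minimum,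
while a back letter or a join adds one minimum to those already there. -/
theorem sum_insertLetter_open {a b : ℕ} (ha : 0 < a) (hab : a < b) {T : List (List ℕ)} (g : ℕ)
    (hT : TupleAbove a T) :
    ((insertLetter a T).map fun K =>
        if K.length = g + 1 then q ^ tupleOcc K * y ^ headMinima b K else 0).sum =
      (∑ j ∈ Finset.range g, q ^ j) *
        ((if T.length = g then q ^ tupleOcc T * y ^ headMinima b T else 0) +
          2 * (if T.length = g + 1 then q ^ tupleOcc T * y ^ headMinima b T else 0) +
          (if T.length = g + 2 then q ^ tupleOcc T * y ^ headMinima b T else 0)) +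
      y * q ^ g * ((if T.length = g then q ^ tupleOcc T else 0) +
          (if T.length = g + 1 then q ^ tupleOcc T else 0) +
          (if T.length = g + 1 then q ^ tupleOcc T * y ^ headMinima b T else 0) +
          (if T.length = g + 2 then q ^ tupleOcc T * y ^ headMinima b T else 0)) := by
  have hnil : TupleAbove a [] := by intro L hL; simp at hL
  cases T with
  | nil =>
    have h := tupleOcc_insert_new ha hnil (Q := []) hnil
    simp only [List.nil_append] at h
    simp only [insertLetter, List.map_cons, List.map_nil, List.sum_cons, List.sum_nil,
      List.length_cons, List.length_nil, h]
    rcases g with _ | g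
    · simp [headMinima, minimaBelow, hab, mul_comm]
    · simp
  | cons L Q =>
    have h1 := tupleOcc_insert_new ha hnil hT
    have h2 := tupleOcc_insert_front ha hnil hT
    have h3 := tupleOcc_insert_back ha hnil hT
    simp only [List.nil_append, List.length_cons] at h1 h2 h3
    have hL := (hT L (by simp)).2
    have m1 : headMinima b ([a] :: L :: Q) = 1 := by simp [headMinima, minimaBelow, hab]
    have m2 : headMinima b ((a :: L) :: Q) = 1 := by
      simpa [headMinima, minimaBelow] using minimaBelow_insert_min hab (A := []) (by simp) hL
    have m3 : headMinima b ((L ++ [a]) :: Q) = headMinima b (L :: Q) + 1 := by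
      simpa [headMinima] using minimaBelow_insert_min hab hL (B := []) (by simp)
    have h4 : (((match Q with
        | [] => []
        | M :: R => [(L ++ a :: M) :: R]).map fun K : List (List ℕ) =>
          if K.length = g + 1 then q ^ tupleOcc K * y ^ headMinima b K else 0).sum : A) =
        if Q.length = g + 1 then q ^ (tupleOcc (L :: Q) + g) * y ^ (headMinima b (L :: Q) + 1)
        else 0 := by
      cases Q with
      | nil => simp
      | cons M R =>
        have h5 := tupleOcc_insert_join ha hnil hT
        have m4 : headMinima b ((L ++ a :: M) :: R) = headMinima b (L :: M :: R) + 1 := by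
          simpa [headMinima] using minimaBelow_insert_min hab hL (hT M (by simp)).2
        rw [List.nil_append, List.nil_append] at h5
        simp only [List.map_cons, List.map_nil, List.sum_cons, List.sum_nil, List.length_cons,
          h5, m4, add_zero, add_left_inj]
        split_ifs with h
        · rw [h]
        · rfl
    have h5 := sum_insertLetter_closed q ha g [L] (hnil.append_singleton hT) hT.tail
    simp only [List.singleton_append] at h5
    have h6 : (((insertLetter a Q).map fun K => if K.length = g then
          q ^ tupleOcc (L :: K) * y ^ headMinima b (L :: K) else 0).sum : A) =
        (q ^ tupleOcc (L :: Q) * (∑ j ∈ Finset.range g, q ^ j) *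
        ((if Q.length + 1 = g then 1 else 0) + 2 * (if Q.length = g then 1 else 0) +
          (if Q.length = g + 1 then 1 else 0))) * y ^ headMinima b (L :: Q) := by
      rw [← h5, ← List.sum_map_mul_right]
      simp only [headMinima, ite_mul, zero_mul]
    simp only [insertLetter, List.map_cons, List.sum_cons, List.map_append, List.sum_append,
      List.map_map, h4, Function.comp_def, List.length_cons, add_left_inj, h1, h2, h3, h6, m1, m2,
      m3]
    by_cases c1 : Q.length + 1 = g
    · subst c1
      simp [show ¬ Q.length = Q.length + 1 + 1 by omega]
      ring
    · by_cases c2 : Q.length = g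
      · subst c2
        simp
        ring
      · by_cases c3 : Q.length = g + 1
        · simp [c3, show ¬ g + 1 + 1 = g by omega]
          ring
        · simp [c1, c2, c3]

theorem sum_tuplesOn_closed {b : ℕ} {S : List ℕ} (hS : (b :: S).Pairwise (· < ·)) (g : ℕ) :
    ((tuplesOn S).map fun T => if T.length = g then q ^ tupleOcc T else 0).sum =
      closedWeight q S.length g := by
  induction S generalizing b g with
  | nil => simp [tuplesOn, closedWeight, tupleOcc, listOcc, eq_comm]
  | cons a S ih =>
    have ih := fun g => ih hS.tail g
    have ha : 0 < a := (Nat.zero_le b).trans_lt (List.rel_of_pairwise_cons hS (by simp))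
    have hT := fun T (hT : T ∈ tuplesOn S) => tupleAbove_of_mem_tuplesOn hS.tail hT
    have hnil : TupleAbove a [] := by intro L hL; simp at hL
    rw [tuplesOn, sum_map_flatMap]
    have h := fun T (h : T ∈ tuplesOn S) =>
      sum_insertLetter_closed q ha g [] hnil (hT T h)
    simp only [List.nil_append] at h
    rw [List.map_congr_left h]
    cases g with
    | zero => simp [closedWeight]
    | succ g =>
      rw [List.length_cons, closedWeight, ← ih, ← ih, ← ih, ← List.sum_map_mul_left,
        ← List.sum_map_add, ← List.sum_map_add, ← List.sum_map_mul_left]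
      congr 1
      refine List.map_congr_left fun T _ => ?_
      simp only [add_left_inj, ← mul_boole (_ = _) (q ^ tupleOcc T)]
      ring

theorem sum_tuplesOn_open {b c : ℕ} {S : List ℕ} (hS : (b :: S).Pairwise (· < ·))
    (hc : ∀ x ∈ S, x < c) (g : ℕ) :
    ((tuplesOn S).map fun T =>
        if T.length = g then q ^ tupleOcc T * y ^ headMinima c T else 0).sum =
      openWeight q y S.length g := by
  induction S generalizing b g with
  | nil => simp [tuplesOn, openWeight, tupleOcc, listOcc, headMinima, eq_comm]
  | cons a S ih =>
    have ih := fun g => ih hS.tail (fun x hx => hc x (by simp [hx])) g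
    have ha : 0 < a := (Nat.zero_le b).trans_lt (List.rel_of_pairwise_cons hS (by simp))
    have hT := fun T (hT : T ∈ tuplesOn S) => tupleAbove_of_mem_tuplesOn hS.tail hT
    rw [tuplesOn, sum_map_flatMap]
    cases g with
    | zero =>
      simp only [List.length_cons, openWeight]
      refine List.sum_eq_zero fun x hx => ?_
      obtain ⟨T, hT, rfl⟩ := List.mem_map.1 hx
      refine List.sum_eq_zero fun x hx => ?_
      obtain ⟨K, hK, rfl⟩ := List.mem_map.1 hx
      rw [if_neg (length_pos_of_mem_insertLetter hK).ne']
    | succ g =>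
      have h := fun T (h : T ∈ tuplesOn S) =>
        sum_insertLetter_open q y ha (hc a (by simp)) g (hT T h)
      rw [List.map_congr_left h, List.length_cons, openWeight]
      simp only [List.sum_map_add, List.sum_map_mul_left, ih, sum_tuplesOn_closed q hS.tail]

end Sums

/-- At q = 1 a tuple is an ordering of the k+1 letters with g of the k gaps cut. Only one block is
needed later, but the recurrence involves every g. -/
theorem closedWeight_one (k g : ℕ) :
    closedWeight (1 : ℕ) (k + 1) (g + 1) = (k + 1).factorial * k.choose g := by
  induction k generalizing g with
  | zero =>
    rcases g with _ | g
    · simp [closedWeight]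
    · simp [closedWeight]
  | succ k ih =>
    have h1 := Nat.add_one_mul_choose_eq (k + 1) g
    have h2 := Nat.factorial_succ (k + 1)
    rw [closedWeight, ih, ih, h2]
    simp only [one_pow, Finset.sum_const, Finset.card_range, smul_eq_mul, mul_one]
    cases g with
    | zero =>
      simp [closedWeight]
      ring
    | succ g =>
      rw [ih]
      have e1 := Nat.choose_succ_succ' (k + 1) (g + 1)
      have e2 := Nat.choose_succ_succ' k g
      have e3 := Nat.choose_succ_succ' k (g + 1)
      rw [e1, e2, e3] at h1
      rw [e2]
      zify at h1 ⊢
      linear_combination (-(k + 1).factorial : ℤ) * h1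

/-! ### Flattening a cycle form: seams, minima and unique decomposition. -/

section Lists

variable {α : Type*} [LinearOrder α]

theorem straddleCount_map {β : Type*} [LinearOrder β] {f : α → β} (hf : StrictMono f) (u : α)
    (l : List α) : straddleCount (f u) (l.map f) = straddleCount u l := by
  induction l with
  | nil => rfl
  | cons v l ih => cases l with
    | nil => rfl
    | cons w l => simpa [straddleCount, hf.lt_iff_lt] using ih

theorem listOcc_map {β : Type*} [LinearOrder β] {f : α → β} (hf : StrictMono f) (l : List α) :
    listOcc (l.map f) = listOcc l := by
  induction l with
  | nil => rfl
  | cons v l ih => simp [listOcc, ih, straddleCount_map hf]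

/-- The pair at the seam is a descent, so it straddles nothing. -/
theorem straddleCount_append {c D : List α} (h : ∀ x ∈ c, ∀ y ∈ D.head?, y < x) (u : α) :
    straddleCount u (c ++ D) = straddleCount u c + straddleCount u D := by
  induction c with
  | nil => simp [straddleCount]
  | cons x c ih =>
    have ih' := ih fun z hz => h z (by simp [hz])
    cases c with
    | nil =>
      cases D with
      | nil => simp [straddleCount]
      | cons y D =>
        have hy := h x (by simp) y (by simp)
        simp only [List.cons_append, List.nil_append, straddleCount]
        rw [if_neg fun h' => lt_asymm hy (h'.1.trans h'.2)]
    | cons z c =>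
      simp only [List.cons_append, straddleCount] at ih' ⊢
      rw [ih', add_assoc]

theorem listOcc_append {c D : List α} (h : ∀ x ∈ c, ∀ y ∈ D.head?, y < x) :
    listOcc (c ++ D) = listOcc c + (c.map fun u => straddleCount u D).sum + listOcc D := by
  induction c with
  | nil => simp [listOcc]
  | cons x c ih =>
    have h' : ∀ z ∈ c, ∀ y ∈ D.head?, y < z := fun z hz => h z (by simp [hz])
    simp only [List.cons_append, listOcc, ih h', straddleCount_append h', List.map_cons,
      List.sum_cons]
    ring

/-- A list of nonempty lists, each starting with its unique smallest entry, these smallest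
entries being smaller than all entries of earlier lists. -/
def IsCycleForm (C : List (List α)) : Prop :=
  (∀ c ∈ C, ∃ a l, c = a :: l ∧ ∀ x ∈ l, a < x) ∧
    C.Pairwise fun c d => ∀ x ∈ c, ∀ y ∈ d.head?, y < x

theorem IsCycleForm.tail {c : List α} {C : List (List α)} (h : IsCycleForm (c :: C)) :
    IsCycleForm C := ⟨fun d hd => h.1 d (by simp [hd]), h.2.tail⟩

theorem IsCycleForm.head_flatten_lt {c : List α} {C : List (List α)} (h : IsCycleForm (c :: C)) :
    ∀ x ∈ c, ∀ y ∈ C.flatten.head?, y < x := by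
  intro x hx y hy
  cases C with
  | nil => simp at hy
  | cons d C =>
    obtain ⟨a, l, rfl, -⟩ := h.1 d (by simp)
    exact List.rel_of_pairwise_cons h.2 (List.mem_cons_self) x hx y (by simpa using hy)

theorem IsCycleForm.straddleCount_flatten {C : List (List α)} (h : IsCycleForm C) (u : α) :
    straddleCount u C.flatten = (C.map (straddleCount u)).sum := by
  induction C with
  | nil => rfl
  | cons c C ih =>
    rw [List.flatten_cons, straddleCount_append h.head_flatten_lt, ih h.tail, List.map_cons,
      List.sum_cons]

theorem IsCycleForm.minimaBelow_flatten {C : List (List α)} (h : IsCycleForm C) {b : α}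
    (hb : ∀ x ∈ C.flatten, x < b) : minimaBelow b C.flatten = C.length := by
  induction C generalizing b with
  | nil => rfl
  | cons c C ih =>
    have key : ∀ (a : α) (l D : List α), (∀ x ∈ l, a < x) →
        minimaBelow a (l ++ D) = minimaBelow a D := by
      intro a l D hl
      induction l with
      | nil => rfl
      | cons x l ih =>
        rw [List.cons_append, minimaBelow, if_neg (not_lt.2 (hl x (by simp)).le),
          ih fun z hz => hl z (by simp [hz])]
    -- The threshold may drop to the head of the current cycle, because the next cycle starts below
    -- both values.
    have key2 : ∀ b' b : α, ∀ D : List α, b' ≤ b → (∀ y ∈ D.head?, y < b') →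
        minimaBelow b' D = minimaBelow b D := by
      intro b' b D hb' hD
      cases D with
      | nil => rfl
      | cons y D =>
        have hy : y < b' := hD y (by simp)
        simp [minimaBelow, hy, hy.trans_le hb']
    obtain ⟨a, l, rfl, hl⟩ := h.1 c (by simp)
    have hab : a < b := hb a (by simp)
    rw [List.flatten_cons, List.cons_append, minimaBelow, if_pos hab, key a l _ hl,
      key2 a b _ hab.le fun y hy => h.head_flatten_lt a (by simp) y hy,
      ih h.tail fun x hx => hb x (by rw [List.flatten_cons]; exact List.mem_append_right _ hx),
      List.length_cons]

/-- If one first cycle were longer, the letter following the shorter one would start a new cycle in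
one form, hence lie below everything before it, and continue a cycle in the other, hence exceed that
cycle's first letter. -/
theorem IsCycleForm.eq_of_flatten_eq {C D : List (List α)} (hC : IsCycleForm C)
    (hD : IsCycleForm D) (h : C.flatten = D.flatten) : C = D := by
  induction C generalizing D with
  | nil =>
    cases D with
    | nil => rfl
    | cons d D =>
      obtain ⟨a, l, rfl, -⟩ := hD.1 d (by simp)
      simp at h
  | cons c C ih =>
    cases D with
    | nil =>
      obtain ⟨a, l, rfl, -⟩ := hC.1 c (by simp)
      simp at h
    | cons d D =>
      have key : ∀ {c d : List α} {C D : List (List α)}, IsCycleForm (c :: C) →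
          IsCycleForm (d :: D) → ∀ e, d = c ++ e → C.flatten = e ++ D.flatten → e = [] := by
        intro c d C D hC hD e he hCD
        cases e with
        | nil => rfl
        | cons y e =>
          obtain ⟨a, l, rfl, hl⟩ := hC.1 c (by simp)
          have h1 := hC.head_flatten_lt a (by simp) y (by simp [hCD])
          obtain ⟨a', l', rfl, hl'⟩ := hD.1 d (by simp)
          rw [List.cons_append, List.cons.injEq] at he
          obtain ⟨rfl, rfl⟩ := he
          exact absurd (hl' y (by simp)) (lt_asymm h1)
      rw [List.flatten_cons, List.flatten_cons, List.append_eq_append_iff] at h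
      rcases h with ⟨e, he, hCD⟩ | ⟨e, he, hCD⟩
      · obtain rfl := key hC hD e he hCD
        rw [List.append_nil] at he
        rw [he, ih hC.tail hD.tail (by simpa using hCD)]
      · obtain rfl := key hD hC e he hCD
        rw [List.append_nil] at he
        rw [he, ih hC.tail hD.tail (by simpa using hCD.symm)]

theorem sum_adjacent_eq_straddleCount (u : α) (c : List α) :
    (∑ s : Fin c.length, ∑ t : Fin c.length,
      if (s : ℕ) + 1 = t ∧ c.get s < u ∧ u < c.get t then 1 else 0) = straddleCount u c := by
  induction c with
  | nil => rfl
  | cons v c ih =>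
    simp only [List.length_cons, Fin.sum_univ_succ]
    cases c with
    | nil => simp [straddleCount]
    | cons w c =>
      simp only [List.length_cons, Fin.sum_univ_succ] at ih ⊢
      simp [straddleCount] at ih ⊢
      rw [← ih]

theorem sum_eq_listOcc (c : List α) :
    (∑ i : Fin c.length, ∑ s : Fin c.length, ∑ t : Fin c.length,
      if (s : ℕ) + 1 = t ∧ c.get s < c.get i ∧ c.get i < c.get t ∧ i < s then 1 else 0) =
      listOcc c := by
  induction c with
  | nil => rfl
  | cons v c ih =>
    rw [listOcc, ← ih, ← sum_adjacent_eq_straddleCount]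
    simp only [List.length_cons, Fin.sum_univ_succ]
    simp

/-- The number of occurrences of 2–13 between different lists of a list of lists. -/
def occAcross : List (List α) → ℕ
  | [] => 0
  | c :: C => (c.map fun u => (C.map (straddleCount u)).sum).sum + occAcross C

theorem sum_get_eq_sum_map {β : Type*} (C : List β) (f : β → ℕ) :
    ∑ a : Fin C.length, f (C.get a) = (C.map f).sum := by
  simp

theorem sum_eq_occAcross (C : List (List α)) :
    (∑ a : Fin C.length, ∑ i : Fin (C.get a).length, ∑ b : Fin C.length,
      if a < b then straddleCount ((C.get a).get i) (C.get b) else 0) = occAcross C := by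
  induction C with
  | nil => rfl
  | cons c C ih =>
    rw [occAcross, ← ih]
    simp only [List.length_cons, Fin.sum_univ_succ]
    simp
    exact sum_get_eq_sum_map c fun u => (C.map (straddleCount u)).sum

theorem IsCycleForm.listOcc_flatten {C : List (List α)} (h : IsCycleForm C) :
    listOcc C.flatten = occAcross C + (C.map listOcc).sum := by
  induction C with
  | nil => rfl
  | cons c C ih =>
    rw [List.flatten_cons, listOcc_append h.head_flatten_lt, ih h.tail, occAcross,
      List.map_cons, List.sum_cons]
    simp only [h.tail.straddleCount_flatten]
    ring

end Lists

/-! ### Occurrences by position versus occurrences in lists. -/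

section Positions

variable {n : ℕ} (π : Equiv.Perm (Fin n))

theorem card_occBetween : (occBetween π).card = occAcross (standardCycleForm π) := by
  rw [← sum_eq_occAcross, occBetween, Finset.card_filter, Fintype.sum_prod_type,
    Fintype.sum_sigma]
  refine Finset.sum_congr rfl fun a _ => Finset.sum_congr rfl fun i _ => ?_
  rw [Fintype.sum_prod_type, Fintype.sum_sigma]
  refine Finset.sum_congr rfl fun b _ => ?_
  rw [← sum_adjacent_eq_straddleCount]
  split_ifs with hab
  · refine Finset.sum_congr rfl fun s _ => ?_
    rw [Fintype.sum_sigma, Finset.sum_eq_single b]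
    · simp [letterAt, hab]
    · intro b' _ hb'
      simp [hb'.symm]
    · simp
  · simp [hab]

theorem card_occWithin :
    (occWithin π).card = ((standardCycleForm π).map listOcc).sum := by
  rw [← sum_get_eq_sum_map, occWithin, Finset.card_filter, Fintype.sum_prod_type,
    Fintype.sum_sigma]
  refine Finset.sum_congr rfl fun a _ => ?_
  rw [← sum_eq_listOcc]
  refine Finset.sum_congr rfl fun i _ => ?_
  rw [Fintype.sum_prod_type, Fintype.sum_sigma, Finset.sum_eq_single a]
  · refine Finset.sum_congr rfl fun s _ => ?_
    rw [Fintype.sum_sigma, Finset.sum_eq_single a]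
    · simp [letterAt]
    · intro b' _ hb'
      simp [hb'.symm]
    · simp
  · intro b _ hb
    simp [hb.symm]
  · simp

end Positions

/-! ### The standard cycle form as a word. -/

section CycleForm

variable {n : ℕ} (π : Equiv.Perm (Fin n))

theorem cycleWord_of_apply_eq_self {c : Fin n} (h : π c = c) : cycleWord π c = [c] := by
  have : (Finset.univ.filter fun x => π.SameCycle c x) = {c} := by
    ext x
    simp only [Finset.mem_filter, Finset.mem_univ, true_and, Finset.mem_singleton]
    constructor
    · intro hx
      exact ((Equiv.Perm.SameCycle.eq_of_left hx h)).symm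
    · rintro rfl
      exact Equiv.Perm.SameCycle.refl _ _
  simp [cycleWord, this]

/-- Fixed points have to be treated apart, since `Equiv.Perm.toList` is empty there. -/
theorem cycleWord_of_mem_support {c : Fin n} (h : c ∈ π.support) :
    cycleWord π c = π.toList c := by
  have : (Finset.univ.filter fun x => π.SameCycle c x) = (π.cycleOf c).support := by
    ext x
    rw [Equiv.Perm.mem_support_cycleOf_iff, and_iff_left h, Finset.mem_filter]
    simp
  rw [cycleWord, Equiv.Perm.toList, this]

theorem mem_cycleWord {c x : Fin n} : x ∈ cycleWord π c ↔ π.SameCycle c x := by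
  by_cases h : π c = c
  · rw [cycleWord_of_apply_eq_self π h, List.mem_singleton]
    constructor
    · rintro rfl
      exact Equiv.Perm.SameCycle.refl _ _
    · intro hx
      exact (Equiv.Perm.SameCycle.eq_of_left hx h).symm
  · have hs : c ∈ π.support := Equiv.Perm.mem_support.2 h
    rw [cycleWord_of_mem_support π hs, Equiv.Perm.mem_toList_iff, and_iff_left hs]

theorem nodup_cycleWord (c : Fin n) : (cycleWord π c).Nodup := by
  by_cases h : π c = c
  · simp [cycleWord_of_apply_eq_self π h]
  · rw [cycleWord_of_mem_support π (Equiv.Perm.mem_support.2 h)]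
    exact Equiv.Perm.nodup_toList π c

theorem formPerm_cycleWord (c : Fin n) : (cycleWord π c).formPerm = π.cycleOf c := by
  by_cases h : π c = c
  · rw [cycleWord_of_apply_eq_self π h, List.formPerm_singleton,
      (Equiv.Perm.cycleOf_eq_one_iff π).2 h]
  · rw [cycleWord_of_mem_support π (Equiv.Perm.mem_support.2 h), Equiv.Perm.formPerm_toList]

theorem cycleWord_eq_cons (c : Fin n) : ∃ l, cycleWord π c = c :: l := by
  have hpos : 0 < (Finset.univ.filter fun x => π.SameCycle c x).card :=
    Finset.card_pos.2 ⟨c, by simp [Equiv.Perm.SameCycle.refl]⟩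
  obtain ⟨k, hk⟩ := Nat.exists_eq_succ_of_ne_zero hpos.ne'
  exact ⟨_, by rw [cycleWord, hk, List.iterate]⟩

theorem mem_standardCycleForm {w : List (Fin n)} : w ∈ standardCycleForm π ↔
    ∃ c, (∀ x, π.SameCycle c x → c ≤ x) ∧ cycleWord π c = w := by
  simp [standardCycleForm]

theorem exists_minimal_sameCycle (x : Fin n) :
    ∃ c, (∀ y, π.SameCycle c y → c ≤ y) ∧ π.SameCycle c x := by
  obtain ⟨c, hc, hmin⟩ := Finset.exists_min_image (Finset.univ.filter fun y => π.SameCycle x y) id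
    ⟨x, by simp [Equiv.Perm.SameCycle.refl]⟩
  simp only [Finset.mem_filter, Finset.mem_univ, true_and, id] at hc hmin
  exact ⟨c, fun y hy => hmin y (hc.trans hy), hc.symm⟩

theorem isCycleForm_standardCycleForm : IsCycleForm (standardCycleForm π) := by
  constructor
  · intro w hw
    obtain ⟨c, hc, rfl⟩ := (mem_standardCycleForm π).1 hw
    obtain ⟨l, hl⟩ := cycleWord_eq_cons π c
    refine ⟨c, l, hl, fun x hx => lt_of_le_of_ne (hc x ?_) ?_⟩
    · rw [← mem_cycleWord, hl]
      exact List.mem_cons_of_mem _ hx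
    · have := nodup_cycleWord π c
      rw [hl, List.nodup_cons] at this
      rintro rfl
      exact this.1 hx
  · rw [standardCycleForm, List.pairwise_map]
    have h1 := Finset.pairwise_sort
      (Finset.univ.filter fun c => ∀ x, π.SameCycle c x → c ≤ x) (fun a b => b ≤ a)
    have h2 := Finset.sort_nodup
      (Finset.univ.filter fun c => ∀ x, π.SameCycle c x → c ≤ x) (fun a b => b ≤ a)
    refine (List.Pairwise.and_mem.1 (h1.and h2)).imp ?_
    rintro c d ⟨hc, -, hdc, hne⟩ x hx y hy
    obtain ⟨l, hl⟩ := cycleWord_eq_cons π d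
    rw [hl, List.head?_cons, Option.mem_some_iff] at hy
    subst hy
    rw [Finset.mem_sort, Finset.mem_filter] at hc
    exact lt_of_lt_of_le (lt_of_le_of_ne hdc hne.symm) (hc.2 x ((mem_cycleWord π).1 hx))

theorem mem_flatten_standardCycleForm (x : Fin n) : x ∈ (standardCycleForm π).flatten := by
  obtain ⟨c, hc, hx⟩ := exists_minimal_sameCycle π x
  exact List.mem_flatten.2 ⟨_, (mem_standardCycleForm π).2 ⟨c, hc, rfl⟩, (mem_cycleWord π).2 hx⟩

theorem nodup_flatten_standardCycleForm : (standardCycleForm π).flatten.Nodup := by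
  rw [List.nodup_flatten]
  constructor
  · intro w hw
    obtain ⟨c, -, rfl⟩ := (mem_standardCycleForm π).1 hw
    exact nodup_cycleWord π c
  · rw [standardCycleForm, List.pairwise_map]
    have h2 := Finset.sort_nodup
      (Finset.univ.filter fun c => ∀ x, π.SameCycle c x → c ≤ x) (fun a b => b ≤ a)
    refine (List.Pairwise.and_mem.1 h2).imp ?_
    rintro c d ⟨hc, hd, hne⟩ x hx hx'
    rw [Finset.mem_sort, Finset.mem_filter] at hc hd
    rw [mem_cycleWord] at hx hx'
    exact hne (le_antisymm (hc.2 d (hx.trans hx'.symm)) (hd.2 c (hx'.trans hx.symm)))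

/-- A common cycle word has the same first letter for both permutations, and its `formPerm` is the
cycle of each through that letter; so both act alike on it. -/
theorem standardCycleForm_injective :
    Function.Injective (standardCycleForm : Equiv.Perm (Fin n) → _) := by
  intro π σ h
  ext x : 1
  obtain ⟨c, hc, hx⟩ := exists_minimal_sameCycle π x
  have hw : cycleWord π c ∈ standardCycleForm σ := by
    rw [← h, mem_standardCycleForm]
    exact ⟨c, hc, rfl⟩
  obtain ⟨d, -, hdw⟩ := (mem_standardCycleForm σ).1 hw
  obtain rfl : d = c := by
    obtain ⟨l, hl⟩ := cycleWord_eq_cons π c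
    obtain ⟨l', hl'⟩ := cycleWord_eq_cons σ d
    rw [hl, hl'] at hdw
    exact (List.cons.inj hdw).1
  have hx' : σ.SameCycle d x := by rwa [← mem_cycleWord, hdw, mem_cycleWord]
  rw [← hx.cycleOf_apply, ← hx'.cycleOf_apply, ← formPerm_cycleWord, ← formPerm_cycleWord, hdw]

/-- The standard cycle form without parentheses, as a word in the letters `1, …, n`. -/
def cycleLetters : List ℕ := (standardCycleForm π).flatten.map fun x : Fin n => (x : ℕ) + 1

theorem strictMono_val_add_one : StrictMono fun x : Fin n => (x : ℕ) + 1 :=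
  fun _ _ h => Nat.add_lt_add_right h 1

theorem cycleLetters_injective :
    Function.Injective (cycleLetters : Equiv.Perm (Fin n) → List ℕ) := fun π σ h =>
  standardCycleForm_injective <| (isCycleForm_standardCycleForm π).eq_of_flatten_eq
    (isCycleForm_standardCycleForm σ) <| strictMono_val_add_one.injective.list_map h

theorem cycleLetters_perm : (cycleLetters π).Perm (List.range' 1 n) := by
  have h : (standardCycleForm π).flatten.Perm (List.finRange n) :=
    (List.perm_ext_iff_of_nodup (nodup_flatten_standardCycleForm π) (List.nodup_finRange n)).2
      fun x => by simp only [mem_flatten_standardCycleForm, List.mem_finRange]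
  refine (h.map _).trans (List.Perm.of_eq ?_)
  refine List.ext_getElem (by simp) fun i h1 h2 => ?_
  simp [add_comm]

/-- The shift to letters 1, …, n is monotone, hence harmless, and leaves 0 free as a separator. -/
theorem listOcc_cycleLetters : listOcc (cycleLetters π) = cyclicOcc π := by
  rw [cycleLetters, listOcc_map strictMono_val_add_one,
    (isCycleForm_standardCycleForm π).listOcc_flatten, cyclicOcc, card_occBetween, card_occWithin]

theorem IsCycleForm.map {α β : Type*} [LinearOrder α] [LinearOrder β] {f : α → β}
    (hf : StrictMono f) {C : List (List α)} (h : IsCycleForm C) :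
    IsCycleForm (C.map (List.map f)) := by
  refine ⟨?_, ?_⟩
  · intro c hc
    obtain ⟨w, hw, rfl⟩ := List.mem_map.1 hc
    obtain ⟨a, l, rfl, hl⟩ := h.1 w hw
    refine ⟨_, _, rfl, fun x hx => ?_⟩
    obtain ⟨z, hz, rfl⟩ := List.mem_map.1 hx
    exact hf (hl z hz)
  · rw [List.pairwise_map]
    refine h.2.imp ?_
    intro c d hcd x hx y hy
    obtain ⟨v, hv, rfl⟩ := List.mem_map.1 hx
    cases d with
    | nil => simp at hy
    | cons z d =>
      rw [List.map_cons, List.head?_cons, Option.mem_some_iff] at hy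
      subst hy
      exact hf (hcd v hv z (by simp))

theorem minimaBelow_cycleLetters : minimaBelow (n + 1) (cycleLetters π) = numCycles π := by
  have h := (isCycleForm_standardCycleForm π).map strictMono_val_add_one
  have e : cycleLetters π =
      ((standardCycleForm π).map (List.map fun x : Fin n => (x : ℕ) + 1)).flatten := by
    rw [cycleLetters, List.map_flatten]
  rw [e, h.minimaBelow_flatten, List.length_map, numCycles]
  intro x hx
  rw [← e] at hx
  have := (cycleLetters_perm π).mem_iff.1 hx
  rw [List.mem_range'_1] at this
  omega

end CycleForm

/-! ### From permutations to one-block tuples. -/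

theorem pairwise_range'_lt (n : ℕ) : (0 :: List.range' 1 n).Pairwise (· < ·) := by
  have : 0 :: List.range' 1 n = List.range' 0 (n + 1) := by rw [List.range'_succ]
  rw [this]
  exact List.pairwise_lt_range'

/-- Injectivity embeds the permutations among the one-block tuples, and the weight at q = 1 shows
that there are only (n+1)! of the latter. Counting thus replaces proofs that every word comes from a
cycle form and that insertion generates each tuple once. -/
theorem map_cycleLetters_perm_tuplesOn (n : ℕ) :
    (((Finset.univ : Finset (Equiv.Perm (Fin (n + 1)))).toList.map
        fun π => [cycleLetters π]).Perm
      ((tuplesOn (List.range' 1 (n + 1))).filter fun T => T.length = 1)) := by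
  refine List.Subperm.perm_of_length_le (List.subperm_of_subset ?_ ?_) ?_
  · refine List.Nodup.map ?_ (Finset.nodup_toList _)
    intro π σ h
    exact cycleLetters_injective (List.cons.inj h).1
  · intro T hT
    obtain ⟨π, -, rfl⟩ := List.mem_map.1 hT
    rw [List.mem_filter]
    refine ⟨mem_tuplesOn ?_ ?_, by simp⟩
    · intro h
      have := (cycleLetters_perm π).length_eq
      rw [← List.mem_singleton.1 h] at this
      simp at this
    · simpa using cycleLetters_perm π
  · have h := sum_tuplesOn_closed (1 : ℕ) (pairwise_range'_lt (n + 1)) 1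
    rw [List.length_range', closedWeight_one, Nat.choose_zero_right, mul_one] at h
    simp only [one_pow] at h
    rw [List.length_map, Finset.length_toList, Finset.card_univ, Fintype.card_perm,
      Fintype.card_fin, ← h, ← List.countP_eq_length_filter]
    generalize tuplesOn (List.range' 1 (n + 1)) = l
    induction l with
    | nil => rfl
    | cons T l ih =>
      by_cases hT : T.length = 1 <;> simp_all; omega

theorem sum_perm_eq_openWeight {A : Type*} [CommSemiring A] (q y : A) (n : ℕ) :
    ∑ π : Equiv.Perm (Fin (n + 1)), q ^ cyclicOcc π * y ^ numCycles π =
      openWeight q y (n + 1) 1 := by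
  -- The bound n+2 exceeds all letters, so every left-to-right minimum is counted.
  have h := sum_tuplesOn_open q y (c := n + 2) (pairwise_range'_lt (n + 1))
    (by intro x hx; rw [List.mem_range'_1] at hx; omega) 1
  rw [List.length_range'] at h
  have h2 := ((map_cycleLetters_perm_tuplesOn n).map
    fun T => q ^ tupleOcc T * y ^ headMinima (n + 2) T).sum_eq
  rw [← h]
  have h3 : ∀ l : List (List (List ℕ)),
      (l.map fun T => if T.length = 1 then q ^ tupleOcc T * y ^ headMinima (n + 2) T else 0).sum =
      ((l.filter fun T => T.length = 1).map
        fun T => q ^ tupleOcc T * y ^ headMinima (n + 2) T).sum := by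
    intro l
    induction l with
    | nil => rfl
    | cons T l ih =>
      by_cases hT : T.length = 1 <;> simp [hT, ih]
  rw [h3, ← h2, List.map_map, ← Finset.sum_map_toList]
  refine congrArg List.sum (List.map_congr_left fun π _ => ?_)
  simp [tupleOcc, headMinima, listOcc, straddleCount_zero, listOcc_cycleLetters,
    ← minimaBelow_cycleLetters]

/-! ### The tree series and its binomial coefficients. -/

/-- The power series solution `T` of `T = X (1 + T) ^ 2`. -/
noncomputable def treeSeries : PowerSeries ℚ :=
  PowerSeries.X * (PowerSeries.map (Nat.castRingHom ℚ) PowerSeries.catalanSeries) ^ 2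

namespace treeSeries

open PowerSeries

local notation "T" => treeSeries

theorem one_add : 1 + T = PowerSeries.map (Nat.castRingHom ℚ) catalanSeries := by
  have h := congrArg (PowerSeries.map (Nat.castRingHom ℚ)) catalanSeries_sq_mul_X_add_one
  simp only [map_add, map_mul, map_pow, PowerSeries.map_X, map_one] at h
  rw [treeSeries]
  linear_combination h

theorem X_mul : (X : ℚ⟦X⟧) * (1 + T) ^ 2 = T := by rw [one_add, treeSeries]

theorem constantCoeff_eq : constantCoeff T = 0 := by simp [treeSeries]

/-- The inverse of `1 - T`. -/
noncomputable def J : ℚ⟦X⟧ := (1 - T)⁻¹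

theorem J_mul : J * (1 - T) = 1 :=
  PowerSeries.inv_mul_cancel _ (by simp [constantCoeff_eq])

/-- The power series `X (1 + T) = T / (1 + T)`. -/
noncomputable def s : ℚ⟦X⟧ := X * (1 + T)

/-- The constant `1 / 2` as a power series. -/
noncomputable def half : ℚ⟦X⟧ := C (1 / 2)

theorem two_mul_half : 2 * half = 1 := by
  have h : (2 : ℚ⟦X⟧) = C (2 : ℚ) := (map_ofNat C 2).symm
  rw [h, half, ← map_mul]
  norm_num

/-- This is Lagrange inversion for X = T/(1+T)^2, done by hand: T^(a+1) = X T^a (1+T)^2 lowers k,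
and a further factor 1+T is Pascal's rule. -/
theorem coeff_J_mul (k a b : ℕ) :
    coeff k (J * T ^ a * (1 + T) ^ (b + 1)) =
      if a ≤ k then ((2 * k + b).choose (k - a) : ℚ) else 0 := by
  have hstep : ∀ a b, J * T ^ (a + 1) * (1 + T) ^ b = X * (J * T ^ a * (1 + T) ^ (b + 2)) := by
    intro a b
    linear_combination (-J * T ^ a * (1 + T) ^ b) * X_mul
  induction k generalizing a b with
  | zero =>
    rcases a with _ | a
    · have hJ : constantCoeff J = 1 := by simp [J, constantCoeff_eq]
      simp [constantCoeff_eq, hJ]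
    · simp [constantCoeff_eq]
  | succ k ih =>
    have hs : ∀ a b, coeff (k + 1) (J * T ^ (a + 1) * (1 + T) ^ b) =
        if a ≤ k then ((2 * k + (b + 1)).choose (k - a) : ℚ) else 0 := by
      intro a b
      rw [hstep, coeff_succ_X_mul, ih]
    cases a with
    | succ a =>
      rw [hs]
      simp only [Nat.add_le_add_iff_right, Nat.add_sub_add_right]
      rw [show 2 * k + (b + 1 + 1) = 2 * (k + 1) + b by ring]
    | zero =>
      simp only [Nat.zero_le, if_true, Nat.sub_zero]
      induction b with
      | zero =>
        -- The central case: this identity mirrors C(2k+2, k+1) = 2 C(2k+1, k).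
        have e : J * T ^ 0 * (1 + T) ^ (0 + 1) = 1 + 2 * (J * T ^ (0 + 1) * (1 + T) ^ 0) := by
          linear_combination J_mul
        have h2 : (2 : ℚ⟦X⟧) = C (2 : ℚ) := (map_ofNat C 2).symm
        rw [e, map_add, h2, coeff_C_mul, hs, coeff_one, if_neg (by omega)]
        have e2 := Nat.choose_succ_succ' (2 * k + 1) k
        have e3 := Nat.choose_symm_half k
        rw [show 2 * (k + 1) + 0 = 2 * k + 1 + 1 by ring, e2, e3]
        simp
        ring
      | succ b ihb =>
        have e : J * T ^ 0 * (1 + T) ^ (b + 1 + 1) = J * T ^ 0 * (1 + T) ^ (b + 1) +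
            J * T ^ (0 + 1) * (1 + T) ^ (b + 1) := by ring
        rw [e, map_add, ihb, hs]
        rw [show 2 * (k + 1) + (b + 1) = 2 * (k + 1) + b + 1 by ring, Nat.choose_succ_succ']
        rw [show 2 * (k + 1) + b = 2 * k + (b + 1 + 1) by ring]
        simp [add_comm]

set_option linter.unusedSimpArgs false

/-! ### Candidate series for zero, one and two occurrences. -/

/-- Coefficient of `g` in the generating functions of tuples with one occurrence. -/
noncomputable def slope : ℚ⟦X⟧ := (1 + T) * J

/-- Coefficient of `g ^ 2` in the generating functions of tuples with two occurrences. -/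
noncomputable def curv : ℚ⟦X⟧ := half * slope ^ 2

/-- Coefficient of `g` in the generating functions of tuples with two occurrences. -/
noncomputable def closedLin : ℚ⟦X⟧ := -(1 + T) ^ 3 * J + half * (1 + T) * (1 + T ^ 2) * J ^ 3

/-- Constant term, as a polynomial in `g`, for tuples with two occurrences. -/
noncomputable def closedConst : ℚ⟦X⟧ :=
  -(1 + T ^ 2) * (1 + T) ^ 2 - closedLin * (1 - T ^ 2) - curv * (1 - 3 * T ^ 2)

/-- Tuples of `g` lists without occurrences. -/
noncomputable def closed0 (g : ℕ) : ℚ⟦X⟧ := T ^ g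

/-- Tuples of `g` lists with one occurrence. -/
noncomputable def closed1 : ℕ → ℚ⟦X⟧
  | 0 => 0
  | g + 1 => T ^ (g + 1) * (-(1 + T) ^ 2 + slope * (g + 1))

/-- Tuples of `g` lists with two occurrences. -/
noncomputable def closed2 : ℕ → ℚ⟦X⟧
  | 0 => 0
  | 1 => T ^ 3 * (closedLin + 3 * curv - (1 + T) ^ 2)
  | g + 2 => T ^ (g + 2) * (closedConst + closedLin * (g + 2) + curv * (g + 2) ^ 2)

/-- Tuples of `g + 1` lists without occurrences, with `m + 1` minima in the first list. -/
noncomputable def open0 (m g : ℕ) : ℚ⟦X⟧ := s ^ (m + 1) * T ^ g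

/-- Constant term, as a polynomial in `g`, for one occurrence and `m + 1` minima. -/
noncomputable def openConst1 (m : ℕ) : ℚ⟦X⟧ := J * (T ^ 3 - 1 + (m - 1) * T)

/-- Tuples of `g + 1` lists with one occurrence, with `m + 1` minima in the first list. -/
noncomputable def open1 (m g : ℕ) : ℚ⟦X⟧ :=
  s ^ (m + 1) * T ^ g * (openConst1 m + slope * (g + 1))

/-- Coefficient of `g` for two occurrences and `m + 1` minima. -/
noncomputable def openLin2 (m : ℕ) : ℚ⟦X⟧ :=
  (1 + T) * J * openConst1 m + half * (1 + T) * (1 + T ^ 2) * J ^ 3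

/-- Single lists with two occurrences and one minimum, divided by `s`. -/
noncomputable def single0 : ℚ⟦X⟧ :=
  T ^ 3 * (-(1 + T) ^ 2 * J + half * (1 + T ^ 2) * J ^ 3 + 3 * half * (1 + T) * J ^ 2 - (1 + T))

/-- Single lists with two occurrences and `m + 1` minima, divided by `s ^ (m + 1)`, for
positive `m`. -/
noncomputable def singlePos (m : ℕ) : ℚ⟦X⟧ :=
  single0 - T * (1 + T) ^ 2 +
    m * (T * J ^ 2 * (T ^ 3 - 1) + half * T * (1 + T ^ 2) * J ^ 3 +
      3 * half * T * (1 + T) * J ^ 2) +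
    half * (m * (m - 3)) * T ^ 2 * J ^ 2

/-- Constant term, as a polynomial in `g`, for two occurrences and `m + 1` minima. -/
noncomputable def openConst2 : ℕ → ℚ⟦X⟧
  | 0 => single0 - (1 + T) ^ 3 - openLin2 0 - curv
  | m + 1 => singlePos (m + 1) - openLin2 (m + 1) - curv

/-- Tuples of `g + 1` lists with two occurrences, with `m + 1` minima in the first list. -/
noncomputable def open2 : ℕ → ℕ → ℚ⟦X⟧
  | 0, 0 => s * single0
  | m + 1, 0 => s ^ (m + 2) * singlePos (m + 1)
  | m, g + 1 =>
    s ^ (m + 1) * T ^ (g + 1) * (openConst2 m + openLin2 m * (g + 2) + curv * (g + 2) ^ 2)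

theorem open2_zero_zero_eq : open2 0 0 = s * single0 := rfl

theorem open2_succ_zero_eq (m : ℕ) : open2 (m + 1) 0 = s ^ (m + 2) * singlePos (m + 1) := rfl

theorem open2_succ_eq (m g : ℕ) : open2 m (g + 1) =
    s ^ (m + 1) * T ^ (g + 1) * (openConst2 m + openLin2 m * (g + 2) + curv * (g + 2) ^ 2) := by
  cases m <;> rfl

section Transfer

local notation "ψ" => algebraMap ℚ⟦X⟧ (FractionRing ℚ⟦X⟧)

theorem algebraMap_one_add_ne_zero : 1 + ψ T ≠ 0 := by
  have h : (1 + T : ℚ⟦X⟧) ≠ 0 := by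
    intro h
    have := congrArg constantCoeff h
    simp [constantCoeff_eq] at this
  have h2 := (map_ne_zero_iff ψ (IsFractionRing.injective _ _)).2 h
  simpa using h2

theorem algebraMap_one_sub_ne_zero : 1 - ψ T ≠ 0 := by
  have h : (1 - T : ℚ⟦X⟧) ≠ 0 := by
    intro h
    have := congrArg constantCoeff h
    simp [constantCoeff_eq] at this
  have h2 := (map_ne_zero_iff ψ (IsFractionRing.injective _ _)).2 h
  simpa using h2

theorem algebraMap_J : ψ J = 1 / (1 - ψ T) := by
  rw [eq_div_iff algebraMap_one_sub_ne_zero]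
  simpa using congrArg ψ J_mul

theorem algebraMap_X : ψ X = ψ T / (1 + ψ T) ^ 2 := by
  rw [eq_div_iff (pow_ne_zero _ algebraMap_one_add_ne_zero)]
  simpa using congrArg ψ X_mul

theorem algebraMap_s : ψ s = ψ T / (1 + ψ T) := by
  have h := algebraMap_one_add_ne_zero
  rw [s, map_mul, algebraMap_X, map_add, map_one]
  field_simp

theorem two_ne_zero_fractionRing : (2 : FractionRing ℚ⟦X⟧) ≠ 0 := by
  have h : (2 : ℚ⟦X⟧) ≠ 0 := by
    intro h
    have := congrArg (fun f => half * f) h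
    simp only [mul_comm half, two_mul_half] at this
    simp at this
  have h2 := (map_ne_zero_iff ψ (IsFractionRing.injective _ _)).2 h
  rwa [map_ofNat] at h2

theorem algebraMap_half : ψ half = 1 / 2 := by
  rw [eq_div_iff two_ne_zero_fractionRing, mul_comm]
  have h := congrArg ψ two_mul_half
  rwa [map_mul, map_ofNat, map_one] at h

/-- An identity between power series may be checked in the field of fractions. -/
theorem eq_of_algebraMap_eq {f g : ℚ⟦X⟧} (h : ψ f = ψ g) : f = g :=
  IsFractionRing.injective _ _ h

end Transfer

/-! ### The candidates satisfy the recurrences order by order in q. -/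

theorem closed0_succ (g : ℕ) :
    closed0 (g + 1) = X * (closed0 g + 2 * closed0 (g + 1) + closed0 (g + 2)) := by
  simp only [closed0]
  linear_combination (-T ^ g) * X_mul

theorem closed1_one :
    closed1 1 = X * (closed1 0 + 2 * closed1 1 + closed1 2) := by
  simp only [closed1, slope]
  apply eq_of_algebraMap_eq
  have h1 := algebraMap_one_add_ne_zero
  have h2 := algebraMap_one_sub_ne_zero
  push_cast
  simp only [map_mul, map_add, map_pow, map_sub, map_neg, map_one, map_ofNat, map_zero,
    algebraMap_X, algebraMap_J]
  field_simp
  ring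

theorem closed1_add_two (g : ℕ) :
    closed1 (g + 2) = X * (closed1 (g + 1) + 2 * closed1 (g + 2) + closed1 (g + 3)) +
      X * (closed0 (g + 1) + 2 * closed0 (g + 2) + closed0 (g + 3)) := by
  simp only [closed1, closed0, slope]
  push_cast
  have key : T * (-(1 + T) ^ 2 + (1 + T) * J * ((g : ℚ⟦X⟧) + 2)) =
      X * ((-(1 + T) ^ 2 + (1 + T) * J * ((g : ℚ⟦X⟧) + 1)) +
        2 * (T * (-(1 + T) ^ 2 + (1 + T) * J * ((g : ℚ⟦X⟧) + 2))) +
        T ^ 2 * (-(1 + T) ^ 2 + (1 + T) * J * ((g : ℚ⟦X⟧) + 3))) + X * (1 + T) ^ 2 := by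
    apply eq_of_algebraMap_eq
    have h1 := algebraMap_one_add_ne_zero
    have h2 := algebraMap_one_sub_ne_zero
    simp only [map_mul, map_add, map_pow, map_sub, map_neg, map_one, map_ofNat, map_natCast,
      algebraMap_X, algebraMap_J]
    field_simp
    ring
  linear_combination T ^ (g + 1) * key

/-- This case forces `closedConst`: since 1 - 2X = (1+T^2)/(1+T)^2, it says (1+T^2) `closed2 1` = T
`closed2 2`. -/
theorem closed2_one :
    closed2 1 = X * (closed2 0 + 2 * closed2 1 + closed2 2) := by
  simp only [closed2, closedConst, curv, closedLin, slope]
  apply eq_of_algebraMap_eq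
  have h1 := algebraMap_one_add_ne_zero
  have h2 := algebraMap_one_sub_ne_zero
  have h3 := two_ne_zero_fractionRing
  push_cast
  simp only [map_mul, map_add, map_pow, map_sub, map_neg, map_one, map_ofNat, map_zero,
    algebraMap_X, algebraMap_J, algebraMap_half]
  field_simp
  ring

/-- Here the geometric sum is 1+q, without q^2. The missing contribution T^2 is why `closed2 1`
exceeds the value of the general formula at g = 1 by T(1+T)^2. -/
theorem closed2_two :
    closed2 2 = X * (closed2 1 + 2 * closed2 2 + closed2 3) +
      X * (closed1 1 + 2 * closed1 2 + closed1 3) := by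
  simp only [closed2, closed1, closedConst, curv, closedLin, slope]
  apply eq_of_algebraMap_eq
  have h1 := algebraMap_one_add_ne_zero
  have h2 := algebraMap_one_sub_ne_zero
  have h3 := two_ne_zero_fractionRing
  push_cast
  simp only [map_mul, map_add, map_pow, map_sub, map_neg, map_one, map_ofNat, map_zero,
    algebraMap_X, algebraMap_J, algebraMap_half]
  field_simp
  ring

theorem closed2_add_three (g : ℕ) :
    closed2 (g + 3) = X * (closed2 (g + 2) + 2 * closed2 (g + 3) + closed2 (g + 4)) +
      X * (closed1 (g + 2) + 2 * closed1 (g + 3) + closed1 (g + 4)) +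
      X * (closed0 (g + 2) + 2 * closed0 (g + 3) + closed0 (g + 4)) := by
  -- The contributions of q and q^2 together are exactly `closed1 (g + 3)`.
  have e1 := closed1_add_two (g + 1)
  have : closed2 (g + 3) = X * (closed2 (g + 2) + 2 * closed2 (g + 3) + closed2 (g + 4)) +
      closed1 (g + 3) := by
    simp only [closed2, closed1]
    push_cast
    have key : T * (closedConst + closedLin * ((g : ℚ⟦X⟧) + 3) + curv * ((g : ℚ⟦X⟧) + 3) ^ 2) =
      X * ((closedConst + closedLin * ((g : ℚ⟦X⟧) + 2) + curv * ((g : ℚ⟦X⟧) + 2) ^ 2) +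
        2 * (T * (closedConst + closedLin * ((g : ℚ⟦X⟧) + 3) + curv * ((g : ℚ⟦X⟧) + 3) ^ 2)) +
        T ^ 2 * (closedConst + closedLin * ((g : ℚ⟦X⟧) + 4) + curv * ((g : ℚ⟦X⟧) + 4) ^ 2)) +
      T * (-(1 + T) ^ 2 + slope * ((g : ℚ⟦X⟧) + 3)) := by
      simp only [closedConst, curv, closedLin, slope]
      apply eq_of_algebraMap_eq
      have h1 := algebraMap_one_add_ne_zero
      have h2 := algebraMap_one_sub_ne_zero
      have h3 := two_ne_zero_fractionRing
      simp only [map_mul, map_add, map_pow, map_sub, map_neg, map_one, map_ofNat, map_natCast,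
        algebraMap_X, algebraMap_J, algebraMap_half]
      field_simp
      ring
    linear_combination T ^ (g + 2) * key
  linear_combination this + e1

theorem open0_zero_zero : open0 0 0 = X * (closed0 0 + closed0 1) := by
  simp [open0, closed0, s]

theorem open0_succ_zero (m : ℕ) : open0 (m + 1) 0 = X * (open0 m 0 + open0 m 1) := by
  simp only [open0]
  rw [pow_succ s (m + 1)]
  nth_rewrite 2 [s]
  ring

theorem open0_succ (m g : ℕ) :
    open0 m (g + 1) = X * (open0 m g + 2 * open0 m (g + 1) + open0 m (g + 2)) := by
  simp only [open0]
  linear_combination (-s ^ (m + 1) * T ^ g) * X_mul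

theorem open0_zero_one : open0 0 1 = X * (closed0 1 + closed0 2) := by
  simp only [open0, closed0, s]
  ring

theorem open0_succ_one (m : ℕ) : open0 (m + 1) 1 = X * (open0 m 1 + open0 m 2) := by
  simp only [open0]
  rw [pow_succ s (m + 1)]
  nth_rewrite 2 [s]
  ring

theorem open0_zero_two : open0 0 2 = X * (closed0 2 + closed0 3) := by
  simp only [open0, closed0, s]
  ring

theorem open0_succ_two (m : ℕ) : open0 (m + 1) 2 = X * (open0 m 2 + open0 m 3) := by
  simp only [open0]
  rw [pow_succ s (m + 1)]
  nth_rewrite 2 [s]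
  ring

theorem open1_zero_zero : open1 0 0 = X * (closed1 0 + closed1 1) := by
  simp only [open1, closed1, slope, openConst1]
  apply eq_of_algebraMap_eq
  have h1 := algebraMap_one_add_ne_zero
  have h2 := algebraMap_one_sub_ne_zero
  push_cast
  simp only [map_mul, map_add, map_pow, map_sub, map_neg, map_one, map_ofNat, map_zero,
    algebraMap_X, algebraMap_J, algebraMap_s]
  field_simp
  ring

theorem open1_succ_zero (m : ℕ) : open1 (m + 1) 0 = X * (open1 m 0 + open1 m 1) := by
  simp only [open1]
  push_cast
  have key : s * (openConst1 (m + 1) + slope) =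
      X * (openConst1 m + slope + T * (openConst1 m + slope * 2)) := by
    simp only [slope, openConst1]
    apply eq_of_algebraMap_eq
    have h1 := algebraMap_one_add_ne_zero
    have h2 := algebraMap_one_sub_ne_zero
    push_cast
    simp only [map_mul, map_add, map_pow, map_sub, map_neg, map_one, map_ofNat, map_natCast,
      algebraMap_X, algebraMap_J, algebraMap_s]
    field_simp
    ring
  linear_combination s ^ (m + 1) * key

/-- The last term has two origins with the same value: the q of the geometric sum if g > 0, and the
term y q for the first block if g = 0. -/
theorem open1_succ' (m g : ℕ) :
    open1 m (g + 1) = X * (open1 m g + 2 * open1 m (g + 1) + open1 m (g + 2)) +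
      open0 m (g + 1) := by
  simp only [open1, open0]
  push_cast
  have key : T * (openConst1 m + slope * ((g : ℚ⟦X⟧) + 2)) =
      X * (openConst1 m + slope * ((g : ℚ⟦X⟧) + 1) + 2 * (T * (openConst1 m + slope * ((g : ℚ⟦X⟧) + 2))) +
        T ^ 2 * (openConst1 m + slope * ((g : ℚ⟦X⟧) + 3))) + T := by
    simp only [slope, openConst1]
    apply eq_of_algebraMap_eq
    have h1 := algebraMap_one_add_ne_zero
    have h2 := algebraMap_one_sub_ne_zero
    simp only [map_mul, map_add, map_pow, map_sub, map_neg, map_one, map_ofNat, map_natCast,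
      algebraMap_X, algebraMap_J]
    field_simp
    ring
  linear_combination s ^ (m + 1) * T ^ g * key

theorem open2_zero_zero : open2 0 0 = X * (closed2 0 + closed2 1) := by
  simp only [open2_zero_zero_eq, open2_succ_zero_eq, open2_succ_eq, closed2, single0, closedLin, curv, slope]
  apply eq_of_algebraMap_eq
  have h1 := algebraMap_one_add_ne_zero
  have h2 := algebraMap_one_sub_ne_zero
  have h3 := two_ne_zero_fractionRing
  simp only [map_mul, map_add, map_pow, map_sub, map_neg, map_one, map_ofNat, map_zero,
    algebraMap_X, algebraMap_J, algebraMap_s, algebraMap_half]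
  field_simp
  ring

theorem open2_one_zero : open2 1 0 = X * (open2 0 0 + open2 0 1) := by
  rw [open2_succ_zero_eq 0, open2_succ_eq 0 0]
  simp only [open2_zero_zero_eq, open2_succ_zero_eq, open2_succ_eq, singlePos, openConst2, openLin2, openConst1, single0, curv, slope]
  apply eq_of_algebraMap_eq
  have h1 := algebraMap_one_add_ne_zero
  have h2 := algebraMap_one_sub_ne_zero
  have h3 := two_ne_zero_fractionRing
  push_cast
  simp only [map_mul, map_add, map_pow, map_sub, map_neg, map_one, map_ofNat, map_zero,
    algebraMap_X, algebraMap_J, algebraMap_s, algebraMap_half]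
  field_simp
  ring

theorem open2_add_two_zero (m : ℕ) :
    open2 (m + 2) 0 = X * (open2 (m + 1) 0 + open2 (m + 1) 1) := by
  rw [open2_succ_eq _ 0]
  simp only [open2_succ_zero_eq, open2_succ_eq]
  have key : s * singlePos (m + 2) = X * (singlePos (m + 1) +
      T * (openConst2 (m + 1) + openLin2 (m + 1) * 2 + curv * 2 ^ 2)) := by
    simp only [singlePos, openConst2, openLin2, openConst1, single0, curv, slope]
    apply eq_of_algebraMap_eq
    have h1 := algebraMap_one_add_ne_zero
    have h2 := algebraMap_one_sub_ne_zero
    have h3 := two_ne_zero_fractionRing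
    push_cast
    simp only [map_mul, map_add, map_pow, map_sub, map_neg, map_one, map_ofNat, map_natCast,
      algebraMap_X, algebraMap_J, algebraMap_s, algebraMap_half]
    field_simp
    ring
  push_cast
  linear_combination s ^ (m + 2) * key

/-- The closed series on the right fall short of `open1 0 1` by s T (1+T). This causes the term
(1+T)^3 in `openConst2 0`, hence the exceptional formula at m = 0. -/
theorem open2_zero_one : open2 0 1 = X * (open2 0 0 + 2 * open2 0 1 + open2 0 2) +
    X * (closed1 1 + closed1 2) := by
  rw [open2_succ_eq 0 0, open2_succ_eq 0 1]
  simp only [open2_zero_zero_eq, open2_succ_zero_eq, open2_succ_eq, closed1, openConst2, openLin2, openConst1, single0, curv, slope]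
  apply eq_of_algebraMap_eq
  have h1 := algebraMap_one_add_ne_zero
  have h2 := algebraMap_one_sub_ne_zero
  have h3 := two_ne_zero_fractionRing
  push_cast
  simp only [map_mul, map_add, map_pow, map_sub, map_neg, map_one, map_ofNat, map_zero,
    algebraMap_X, algebraMap_J, algebraMap_s, algebraMap_half]
  field_simp
  ring

/-- Here the last term equals `open1 (m + 1) 1`, so for a positive index the general formula extends
down to single blocks. -/
theorem open2_succ_one (m : ℕ) : open2 (m + 1) 1 =
    X * (open2 (m + 1) 0 + 2 * open2 (m + 1) 1 + open2 (m + 1) 2) +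
    X * (open1 m 1 + open1 m 2) := by
  rw [open2_succ_eq _ 0, open2_succ_eq _ 1]
  simp only [open2_zero_zero_eq, open2_succ_zero_eq, open2_succ_eq, open1]
  have key : s * (T * (openConst2 (m + 1) + openLin2 (m + 1) * 2 + curv * 2 ^ 2)) =
      s * (X * (singlePos (m + 1) +
        2 * (T * (openConst2 (m + 1) + openLin2 (m + 1) * 2 + curv * 2 ^ 2)) +
        T ^ 2 * (openConst2 (m + 1) + openLin2 (m + 1) * 3 + curv * 3 ^ 2))) +
      X * (T * (openConst1 m + slope * 2) + T ^ 2 * (openConst1 m + slope * 3)) := by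
    simp only [openConst2, singlePos, single0, openLin2, openConst1, curv, slope]
    apply eq_of_algebraMap_eq
    have h1 := algebraMap_one_add_ne_zero
    have h2 := algebraMap_one_sub_ne_zero
    have h3 := two_ne_zero_fractionRing
    push_cast
    simp only [map_mul, map_add, map_pow, map_sub, map_neg, map_one, map_ofNat, map_natCast,
      algebraMap_X, algebraMap_J, algebraMap_s, algebraMap_half]
    field_simp
    ring
  push_cast
  linear_combination s ^ (m + 1) * key

theorem open2_add_two' (m g : ℕ) :
    open2 m (g + 2) = X * (open2 m (g + 1) + 2 * open2 m (g + 2) + open2 m (g + 3)) +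
      open1 m (g + 2) := by
  simp only [open2_zero_zero_eq, open2_succ_zero_eq, open2_succ_eq, open1]
  push_cast
  have key : T * (openConst2 m + openLin2 m * ((g : ℚ⟦X⟧) + 3) + curv * ((g : ℚ⟦X⟧) + 3) ^ 2) =
      X * (openConst2 m + openLin2 m * ((g : ℚ⟦X⟧) + 2) + curv * ((g : ℚ⟦X⟧) + 2) ^ 2 +
        2 * (T * (openConst2 m + openLin2 m * ((g : ℚ⟦X⟧) + 3) + curv * ((g : ℚ⟦X⟧) + 3) ^ 2)) +
        T ^ 2 * (openConst2 m + openLin2 m * ((g : ℚ⟦X⟧) + 4) + curv * ((g : ℚ⟦X⟧) + 4) ^ 2)) +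
      T * (openConst1 m + slope * ((g : ℚ⟦X⟧) + 3)) := by
    generalize openConst2 m = c
    simp only [openLin2, openConst1, curv, slope]
    apply eq_of_algebraMap_eq
    have h1 := algebraMap_one_add_ne_zero
    have h2 := algebraMap_one_sub_ne_zero
    have h3 := two_ne_zero_fractionRing
    simp only [map_mul, map_add, map_pow, map_sub, map_neg, map_one, map_ofNat, map_natCast,
      algebraMap_X, algebraMap_J, algebraMap_half]
    field_simp
    ring
  linear_combination s ^ (m + 1) * T ^ (g + 1) * key

end treeSeries

/-! ### Low coefficients of a geometric sum times a polynomial. -/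

section GeomSum

open Polynomial

variable {R : Type*} [CommRing R] (Z : R[X]) (g : ℕ)

theorem coeff_geom_mul (i : ℕ) : ((∑ j ∈ Finset.range g, X ^ j) * Z).coeff i =
    ∑ j ∈ Finset.range g, if j ≤ i then Z.coeff (i - j) else 0 := by
  rw [Finset.sum_mul, finsetSum_coeff]
  simp only [coeff_X_pow_mul']

theorem coeff_zero_geom_mul : ((∑ j ∈ Finset.range (g + 1), X ^ j) * Z).coeff 0 = Z.coeff 0 := by
  rw [coeff_geom_mul, Finset.sum_range_succ']
  simp

theorem coeff_one_geom_mul : ((∑ j ∈ Finset.range (g + 2), X ^ j) * Z).coeff 1 =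
    Z.coeff 1 + Z.coeff 0 := by
  rw [coeff_geom_mul, Finset.sum_range_succ', Finset.sum_range_succ']
  simp [add_comm]

theorem coeff_two_geom_mul : ((∑ j ∈ Finset.range (g + 3), X ^ j) * Z).coeff 2 =
    Z.coeff 2 + Z.coeff 1 + Z.coeff 0 := by
  rw [coeff_geom_mul, Finset.sum_range_succ', Finset.sum_range_succ', Finset.sum_range_succ']
  simp
  ring

theorem coeff_two_geom_two_mul : ((∑ j ∈ Finset.range 2, X ^ j) * Z).coeff 2 =
    Z.coeff 2 + Z.coeff 1 := by
  rw [coeff_geom_mul, Finset.sum_range_succ', Finset.sum_range_succ']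
  simp
  ring

theorem coeff_geom_one_mul (i : ℕ) : ((∑ j ∈ Finset.range 1, X ^ j) * Z).coeff i = Z.coeff i := by
  simp

theorem coeff_C_mul_X_pow_mul (r : R) (i : ℕ) :
    (C r * X ^ g * Z).coeff i = if g ≤ i then r * Z.coeff (i - g) else 0 := by
  rw [mul_assoc, coeff_C_mul, coeff_X_pow_mul']
  split_ifs <;> simp

end GeomSum

/-! ### Identifying the weights with the candidate series. -/

namespace treeSeries

open PowerSeries

theorem constantCoeff_s : constantCoeff s = 0 := by simp [s]

/-- The weight of tuples, with one variable for the occurrences of 2–13. -/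
noncomputable abbrev closedPoly (k g : ℕ) : Polynomial (Polynomial ℚ) :=
  closedWeight Polynomial.X k g

/-- The weight of tuples, with variables for the occurrences of 2–13 and for the minima. -/
noncomputable abbrev openPoly (k g : ℕ) : Polynomial (Polynomial ℚ) :=
  openWeight Polynomial.X (Polynomial.C Polynomial.X) k g

theorem coeff_closedPoly_zero (k g : ℕ) :
    (closedPoly k g).coeff 0 = Polynomial.C (coeff k (closed0 g)) := by
  induction k generalizing g with
  | zero =>
    cases g <;> simp [closedWeight, closed0, constantCoeff_eq]
  | succ k ih =>
    cases g with
    | zero => simp [closedWeight, closed0, coeff_one]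
    | succ g =>
      rw [closedPoly, closedWeight, coeff_zero_geom_mul, closed0_succ, coeff_succ_X_mul]
      simp only [two_mul, Polynomial.coeff_add, map_add, ih]

theorem coeff_closedPoly_one (k g : ℕ) :
    (closedPoly k g).coeff 1 = Polynomial.C (coeff k (closed1 g)) := by
  induction k generalizing g with
  | zero =>
    cases g <;> simp [closedWeight, closed1, constantCoeff_eq, Polynomial.coeff_one]
  | succ k ih =>
    rcases g with _ | _ | g
    · simp [closedWeight, closed1]
    · rw [closedPoly, closedWeight, coeff_geom_one_mul, closed1_one, coeff_succ_X_mul]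
      simp only [two_mul, Polynomial.coeff_add, map_add, ih]
    · rw [closedPoly, closedWeight, coeff_one_geom_mul, closed1_add_two, map_add,
        coeff_succ_X_mul, coeff_succ_X_mul]
      simp only [two_mul, Polynomial.coeff_add, map_add, ih, coeff_closedPoly_zero]

theorem coeff_closedPoly_two (k g : ℕ) :
    (closedPoly k g).coeff 2 = Polynomial.C (coeff k (closed2 g)) := by
  induction k generalizing g with
  | zero =>
    rcases g with _ | _ | g <;>
      simp [closedWeight, closed2, constantCoeff_eq, Polynomial.coeff_one]
  | succ k ih =>
    rcases g with _ | _ | _ | g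
    · simp [closedWeight, closed2]
    · rw [closedPoly, closedWeight, coeff_geom_one_mul, closed2_one, coeff_succ_X_mul]
      simp only [two_mul, Polynomial.coeff_add, map_add, ih]
    · rw [closedPoly, closedWeight, coeff_two_geom_two_mul, closed2_two, map_add,
        coeff_succ_X_mul, coeff_succ_X_mul]
      simp only [two_mul, Polynomial.coeff_add, map_add, ih, coeff_closedPoly_one]
    · rw [closedPoly, closedWeight, coeff_two_geom_mul, closed2_add_three]
      simp only [two_mul, Polynomial.coeff_add, map_add, ih, coeff_closedPoly_one,
        coeff_closedPoly_zero, coeff_succ_X_mul]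

/-- A nonempty first block has at least one minimum; hence the index m+1 in what follows. -/
theorem coeff_openPoly_coeff_zero (k g i : ℕ) :
    ((openPoly k (g + 1)).coeff i).coeff 0 = 0 := by
  induction k generalizing g i with
  | zero => simp [openWeight]
  | succ k ih =>
    rw [openPoly, openWeight, Polynomial.coeff_add, Polynomial.coeff_add, coeff_C_mul_X_pow_mul,
      coeff_geom_mul, Polynomial.finsetSum_coeff, Finset.sum_eq_zero]
    · split_ifs <;> simp
    · intro j hj
      cases g with
      | zero => simp at hj
      | succ g =>
        split_ifs
        · simp only [two_mul, Polynomial.coeff_add, ih, add_zero]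
        · simp

theorem coeff_openPoly_zero (k g m : ℕ) :
    ((openPoly k (g + 1)).coeff 0).coeff (m + 1) = coeff k (open0 m g) := by
  induction k generalizing g m with
  | zero => simp [openWeight, open0, constantCoeff_s]
  | succ k ih =>
    rcases g with _ | g
    · rw [openPoly, openWeight, Polynomial.coeff_add, coeff_C_mul_X_pow_mul]
      rcases m with _ | m
      · rw [open0_zero_zero, coeff_succ_X_mul]
        simp [coeff_closedPoly_zero, coeff_openPoly_coeff_zero]
      · rw [open0_succ_zero, coeff_succ_X_mul]
        simp [coeff_closedPoly_zero, ih]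
    · rw [openPoly, openWeight, Polynomial.coeff_add, coeff_C_mul_X_pow_mul, coeff_zero_geom_mul,
        open0_succ, coeff_succ_X_mul]
      simp only [two_mul, Polynomial.coeff_add, map_add, ih]
      simp

theorem coeff_openPoly_one (k g m : ℕ) :
    ((openPoly k (g + 1)).coeff 1).coeff (m + 1) = coeff k (open1 m g) := by
  induction k generalizing g m with
  | zero => simp [openWeight, open1, constantCoeff_s]
  | succ k ih =>
    rcases g with _ | _ | g
    · rw [openPoly, openWeight, Polynomial.coeff_add, coeff_C_mul_X_pow_mul]
      rcases m with _ | m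
      · rw [open1_zero_zero, coeff_succ_X_mul]
        simp [coeff_closedPoly_one, coeff_openPoly_coeff_zero]
      · rw [open1_succ_zero, coeff_succ_X_mul]
        simp [coeff_closedPoly_one, ih]
    · rw [openPoly, openWeight, Polynomial.coeff_add, coeff_C_mul_X_pow_mul, coeff_geom_one_mul,
        open1_succ', map_add, coeff_succ_X_mul]
      rcases m with _ | m
      · rw [open0_zero_one, coeff_succ_X_mul]
        simp [two_mul, coeff_closedPoly_zero, coeff_openPoly_coeff_zero, ih]
      · rw [open0_succ_one, coeff_succ_X_mul]
        simp [two_mul, coeff_closedPoly_zero, coeff_openPoly_zero, ih]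
    · rw [openPoly, openWeight, Polynomial.coeff_add, coeff_C_mul_X_pow_mul, coeff_one_geom_mul,
        open1_succ', open0_succ, map_add, coeff_succ_X_mul, coeff_succ_X_mul]
      simp [two_mul, coeff_openPoly_zero, ih]

theorem coeff_openPoly_two (k g m : ℕ) :
    ((openPoly k (g + 1)).coeff 2).coeff (m + 1) = coeff k (open2 m g) := by
  induction k generalizing g m with
  | zero =>
    rcases g with _ | g
    · rcases m with _ | m <;> simp [openWeight, open2, constantCoeff_s]
    · simp [openWeight, open2_succ_eq, constantCoeff_s]
  | succ k ih =>
    rcases g with _ | _ | _ | g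
    · rw [openPoly, openWeight, Polynomial.coeff_add, coeff_C_mul_X_pow_mul]
      rcases m with _ | _ | m
      · rw [open2_zero_zero, coeff_succ_X_mul]
        simp [coeff_closedPoly_two, coeff_openPoly_coeff_zero]
      · rw [open2_one_zero, coeff_succ_X_mul]
        simp [coeff_closedPoly_two, ih]
      · rw [open2_add_two_zero, coeff_succ_X_mul]
        simp [coeff_closedPoly_two, ih]
    · rw [openPoly, openWeight, Polynomial.coeff_add, coeff_C_mul_X_pow_mul, coeff_geom_one_mul]
      rcases m with _ | m
      · rw [open2_zero_one, map_add, coeff_succ_X_mul, coeff_succ_X_mul]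
        simp [two_mul, coeff_closedPoly_one, coeff_openPoly_coeff_zero, ih]
      · rw [open2_succ_one, map_add, coeff_succ_X_mul, coeff_succ_X_mul]
        simp [two_mul, coeff_closedPoly_one, coeff_openPoly_one, ih]
    -- With three blocks the geometric sum stops at q, and the first-block term y q^2 supplies the
    -- missing `open0 m 2`.
    · rw [openPoly, openWeight, Polynomial.coeff_add, coeff_C_mul_X_pow_mul,
        coeff_two_geom_two_mul, open2_add_two', open1_succ', map_add, map_add, coeff_succ_X_mul,
        coeff_succ_X_mul]
      rcases m with _ | m
      · rw [open0_zero_two, coeff_succ_X_mul]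
        simp [two_mul, coeff_closedPoly_zero, coeff_openPoly_one, coeff_openPoly_coeff_zero, ih,
          add_assoc]
      · rw [open0_succ_two, coeff_succ_X_mul]
        simp [two_mul, coeff_closedPoly_zero, coeff_openPoly_zero, coeff_openPoly_one, ih,
          add_assoc]
    · rw [openPoly, openWeight, Polynomial.coeff_add, coeff_C_mul_X_pow_mul, coeff_two_geom_mul,
        open2_add_two', open1_succ', open0_succ, map_add, map_add, coeff_succ_X_mul,
        coeff_succ_X_mul, coeff_succ_X_mul]
      simp [two_mul, coeff_openPoly_zero, coeff_openPoly_one, ih, add_assoc]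

end treeSeries

theorem numPerms_eq_coeff (i j n : ℕ) : (numPerms i j (n + 1) : ℚ) =
    ((treeSeries.openPoly (n + 1) 1).coeff i).coeff j := by
  rw [treeSeries.openPoly, ← sum_perm_eq_openWeight, Polynomial.finsetSum_coeff,
    Polynomial.finsetSum_coeff, numPerms, Finset.card_filter, Nat.cast_sum]
  refine Finset.sum_congr rfl fun π _ => ?_
  rw [← Polynomial.C_pow, Polynomial.coeff_mul_C, Polynomial.coeff_X_pow]
  by_cases h : i = cyclicOcc π <;> by_cases h' : j = numCycles π <;>
    simp [h, h', Polynomial.coeff_X_pow, eq_comm]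

/-! ### Coefficient extraction. -/

namespace treeSeries

open PowerSeries

local notation "T" => treeSeries

theorem X_mul_derivative : X * derivative ℚ T = T * (1 + T) * J := by
  have h := congrArg (derivative ℚ) X_mul
  simp only [Derivation.leibniz, Derivation.leibniz_pow, derivative_X, map_add,
    Derivation.map_one_eq_zero, smul_eq_mul, nsmul_eq_mul] at h
  push_cast at h
  linear_combination (-X * (1 + T) * J) * h +
    ((1 + T) * J + 2 * X * derivative ℚ T * J) * X_mul
    - X * derivative ℚ T * J_mul

theorem X_mul_derivative_J : X * derivative ℚ J = T * (1 + T) * J ^ 3 := by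
  have h := congrArg (derivative ℚ) J_mul
  simp only [Derivation.leibniz, map_sub, Derivation.map_one_eq_zero, smul_eq_mul] at h
  linear_combination X * J * h - X * derivative ℚ J * J_mul + J ^ 2 * X_mul_derivative

theorem X_mul_derivative_s : X * derivative ℚ s = s * J := by
  have h : derivative ℚ s = (1 + T) + X * derivative ℚ T := by
    rw [s]
    simp only [Derivation.leibniz, derivative_X, map_add, Derivation.map_one_eq_zero, smul_eq_mul]
    ring
  rw [h, X_mul_derivative, s]
  linear_combination (-X * (1 + T)) * J_mul

/-- The second-order series contain J^2 and J^3 only in this combination. As X d/dX multiplies the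
coefficient of X^(n+1) by n+1, these powers reduce to a single J. -/
theorem X_mul_derivative_s_pow_mul_J (m : ℕ) :
    X * derivative ℚ (s ^ (m + 1) * J) =
      s ^ (m + 1) * (((m : ℚ⟦X⟧) + 1) * J ^ 2 + T * (1 + T) * J ^ 3) := by
  simp only [Derivation.leibniz, Derivation.leibniz_pow, smul_eq_mul, nsmul_eq_mul]
  push_cast
  linear_combination s ^ (m + 1) * X_mul_derivative_J +
    ((m : ℚ⟦X⟧) + 1) * s ^ m * J * X_mul_derivative_s

/-- The coefficient of `X ^ (n + 1)` in `s ^ (m + 1) * J * T ^ i`. -/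
def shiftedBinom (n m i : ℕ) : ℚ :=
  if m + i ≤ n then ((2 * n - m).choose (n - m - i) : ℚ) else 0

theorem coeff_s_pow_mul (n m i : ℕ) :
    coeff (n + 1) (s ^ (m + 1) * J * T ^ i) = shiftedBinom n m i := by
  have h : s ^ (m + 1) * J * T ^ i = X ^ (m + 1) * (J * T ^ i * (1 + T) ^ (m + 1)) := by
    rw [s, mul_pow]
    ring
  rw [h, coeff_X_pow_mul', shiftedBinom]
  by_cases hm : m ≤ n
  · rw [if_pos (by omega), Nat.add_sub_add_right, coeff_J_mul]
    have e : 2 * (n - m) + m = 2 * n - m := by omega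
    rw [e]
    by_cases hi : m + i ≤ n
    · rw [if_pos hi, if_pos (by omega)]
    · rw [if_neg hi, if_neg (by omega)]
  · rw [if_neg (by omega), if_neg (by omega)]

theorem coeff_s_pow_mul_J (n m : ℕ) :
    coeff (n + 1) (s ^ (m + 1) * J) = shiftedBinom n m 0 := by
  rw [← coeff_s_pow_mul, pow_zero, mul_one]

theorem coeff_X_mul_derivative (n m : ℕ) :
    coeff (n + 1) (X * derivative ℚ (s ^ (m + 1) * J)) = (n + 1) * shiftedBinom n m 0 := by
  rw [coeff_succ_X_mul, coeff_derivative, coeff_s_pow_mul_J, mul_comm]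

/-- The ratio of neighbouring binomials. The factor n-m-i vanishes just where the left side is cut
off, so no side condition is needed. -/
theorem shiftedBinom_succ (n m i : ℕ) :
    ((n : ℚ) + i + 1) * shiftedBinom n m (i + 1) = (n - m - i) * shiftedBinom n m i := by
  unfold shiftedBinom
  rcases lt_trichotomy (m + i) n with h | h | h
  · rw [if_pos (by omega), if_pos (by omega)]
    obtain ⟨k, rfl⟩ := Nat.exists_eq_add_of_lt h
    have e := Nat.choose_succ_right_eq (2 * (m + i + k + 1) - m) k
    rw [show m + i + k + 1 - m - (i + 1) = k by omega, show m + i + k + 1 - m - i = k + 1 by omega]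
    rw [show 2 * (m + i + k + 1) - m - k = m + i + k + 1 + i + 1 by omega] at e
    have e' := congrArg (Nat.cast : ℕ → ℚ) e
    push_cast at e' ⊢
    linear_combination -e'
  · rw [if_neg (by omega)]
    have : (n : ℚ) = m + i := by exact_mod_cast h.symm
    rw [this]
    ring
  · rw [if_neg (by omega), if_neg (by omega)]
    ring

theorem intBinom_eq_shiftedBinom (n m i : ℕ) :
    (intBinom (2 * n - m) (n - m - i) : ℚ) = shiftedBinom n m i := by
  unfold intBinom shiftedBinom
  by_cases h : m + i ≤ n
  · rw [if_pos h, if_neg (by omega)]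
    have e1 : (2 * n - m : ℤ) = ((2 * n - m : ℕ) : ℤ) := by omega
    have e2 : (n - m - i : ℤ).toNat = n - m - i := by omega
    rw [e1, e2, Ring.choose_natCast]
    simp
  · rw [if_neg h, if_pos (by omega)]
    simp

theorem coeff_open0 (n m : ℕ) :
    coeff (n + 1) (open0 m 0) = shiftedBinom n m 0 - shiftedBinom n m 1 := by
  have h : open0 m 0 = s ^ (m + 1) * J * T ^ 0 - s ^ (m + 1) * J * T ^ 1 := by
    rw [open0]
    linear_combination (-s ^ (m + 1)) * J_mul
  rw [h, map_sub, coeff_s_pow_mul, coeff_s_pow_mul]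

theorem coeff_open1 (n m : ℕ) :
    coeff (n + 1) (open1 m 0) = shiftedBinom n m 3 + m * shiftedBinom n m 1 := by
  have h : open1 m 0 = s ^ (m + 1) * J * T ^ 3 + C (m : ℚ) * (s ^ (m + 1) * J * T ^ 1) := by
    rw [open1, openConst1, slope, map_natCast]
    push_cast
    ring
  rw [h, map_add, coeff_C_mul, coeff_s_pow_mul, coeff_s_pow_mul]

theorem single0_eq : single0 = half * (J ^ 2 + T * (1 + T) * J ^ 3) -
    J * (half + T + 2 * T ^ 2 + 3 * T ^ 3 + 2 * T ^ 4) := by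
  rw [single0]
  apply eq_of_algebraMap_eq
  have h1 := algebraMap_one_sub_ne_zero
  have h2 := two_ne_zero_fractionRing
  simp only [map_mul, map_add, map_pow, map_sub, map_neg, map_one, map_ofNat, algebraMap_J,
    algebraMap_half]
  field_simp
  ring

/-- Isolates the combination of `X_mul_derivative_s_pow_mul_J`; the remainder is J times a
polynomial in T, whose coefficients are plain binomials. -/
theorem singlePos_eq (m : ℕ) : singlePos m =
    half * (m + 1) * ((m + 1) * J ^ 2 + T * (1 + T) * J ^ 3) -
    J * (half * (m + 1) ^ 2 + (half * (m * (m + 1)) + 2) * T + (m + 3) * T ^ 2 +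
      (m + 2) * T ^ 3 + T ^ 4) := by
  rw [singlePos, single0]
  apply eq_of_algebraMap_eq
  have h1 := algebraMap_one_sub_ne_zero
  have h2 := two_ne_zero_fractionRing
  simp only [map_mul, map_add, map_pow, map_sub, map_neg, map_one, map_ofNat, map_natCast,
    algebraMap_J, algebraMap_half]
  field_simp
  ring

theorem coeff_open2_zero (n : ℕ) : coeff (n + 1) (open2 0 0) =
    1 / 2 * ((n + 1) * shiftedBinom n 0 0) - 1 / 2 * shiftedBinom n 0 0 - shiftedBinom n 0 1 -
      2 * shiftedBinom n 0 2 - 3 * shiftedBinom n 0 3 - 2 * shiftedBinom n 0 4 := by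
  have h := X_mul_derivative_s_pow_mul_J 0
  have h' : open2 0 0 = C (1 / 2 : ℚ) * (X * derivative ℚ (s ^ (0 + 1) * J)) -
      C (1 / 2 : ℚ) * (s ^ (0 + 1) * J * T ^ 0) - s ^ (0 + 1) * J * T ^ 1 -
      C 2 * (s ^ (0 + 1) * J * T ^ 2) - C 3 * (s ^ (0 + 1) * J * T ^ 3) -
      C 2 * (s ^ (0 + 1) * J * T ^ 4) := by
    rw [h, open2_zero_zero_eq, single0_eq, ← half, map_ofNat, map_ofNat]
    push_cast
    ring
  rw [h']
  simp only [map_sub, coeff_C_mul, coeff_s_pow_mul, coeff_X_mul_derivative]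

theorem coeff_open2_succ (n m : ℕ) : coeff (n + 1) (open2 (m + 1) 0) =
    1 / 2 * (m + 2) * ((n + 1) * shiftedBinom n (m + 1) 0) -
      1 / 2 * (m + 2) ^ 2 * shiftedBinom n (m + 1) 0 -
      (1 / 2 * ((m + 1) * (m + 2)) + 2) * shiftedBinom n (m + 1) 1 -
      (m + 4) * shiftedBinom n (m + 1) 2 - (m + 3) * shiftedBinom n (m + 1) 3 -
      shiftedBinom n (m + 1) 4 := by
  have h := X_mul_derivative_s_pow_mul_J (m + 1)
  have h' : open2 (m + 1) 0 =
      C (1 / 2 * (m + 2) : ℚ) * (X * derivative ℚ (s ^ (m + 1 + 1) * J)) -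
      C (1 / 2 * (m + 2) ^ 2 : ℚ) * (s ^ (m + 1 + 1) * J * T ^ 0) -
      C (1 / 2 * ((m + 1) * (m + 2)) + 2 : ℚ) * (s ^ (m + 1 + 1) * J * T ^ 1) -
      C (m + 4 : ℚ) * (s ^ (m + 1 + 1) * J * T ^ 2) -
      C (m + 3 : ℚ) * (s ^ (m + 1 + 1) * J * T ^ 3) - s ^ (m + 1 + 1) * J * T ^ 4 := by
    rw [h, open2_succ_zero_eq, singlePos_eq]
    simp only [map_mul, map_add, map_pow, map_one, map_natCast, map_ofNat,
      show C (1 / 2 : ℚ) = half from rfl]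
    push_cast
    ring
  rw [h']
  simp only [map_sub, coeff_C_mul, coeff_s_pow_mul, coeff_X_mul_derivative]

end treeSeries

/-! ### The closed formulas. -/

theorem mainTheorem2 (n m : ℕ) :
    (numPerms 0 (m + 1) (n + 1) : ℚ) =
      (intBinom (2 * n - m) (n - m) : ℚ) * (((m : ℚ) + 1) / ((n : ℚ) + 1)) ∧
    (numPerms 1 (m + 1) (n + 1) : ℚ) =
      (intBinom (2 * n - m) (n - m - 1) : ℚ) *
        ((((m : ℚ) + 1) * (n : ℚ) ^ 2 + 3 * ((m : ℚ) - 1) * (n : ℚ)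
            + (m : ℚ) ^ 2 + 9 * (m : ℚ) + 2) /
          (((n : ℚ) + 2) * ((n : ℚ) + 3))) ∧
    (1 ≤ m →
      (numPerms 2 (m + 1) (n + 1) : ℚ) =
        (intBinom (2 * n - m) (n - m - 1) : ℚ) *
          (1 / (2 * ((n : ℚ) + 2) * ((n : ℚ) + 3) * ((n : ℚ) + 4))) *
          (((m : ℚ) + 1) * (n : ℚ) ^ 4
            - (6 - 5 * (m : ℚ) + (m : ℚ) ^ 2) * (n : ℚ) ^ 3
            - (29 - 32 * (m : ℚ) + 3 * (m : ℚ) ^ 2) * (n : ℚ) ^ 2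
            - (66 - 72 * (m : ℚ) + 12 * (m : ℚ) ^ 2 + 2 * (m : ℚ) ^ 3) * (n : ℚ)
            - 20 + 54 * (m : ℚ) - 28 * (m : ℚ) ^ 2 - 6 * (m : ℚ) ^ 3)) ∧
    (numPerms 2 1 (n + 1) : ℚ) = (intBinom (2 * n) (n - 4) : ℚ) * ((n : ℚ) / 2) := by
  have b0 := treeSeries.intBinom_eq_shiftedBinom n m 0
  have b1 := treeSeries.intBinom_eq_shiftedBinom n m 1
  have b4 := treeSeries.intBinom_eq_shiftedBinom n 0 4
  push_cast at b0 b1 b4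
  rw [sub_zero] at b0 b4
  rw [sub_zero] at b4
  have p1 : (n : ℚ) + 1 ≠ 0 := by positivity
  have p2 : (n : ℚ) + 2 ≠ 0 := by positivity
  have p3 : (n : ℚ) + 3 ≠ 0 := by positivity
  have p4 : (n : ℚ) + 4 ≠ 0 := by positivity
  -- Indices 2, 3, 4 reduce to index 1 on dividing by positive numbers. Index 0 keeps an implicit
  -- relation, since n-m may vanish.
  have e0 : ∀ m : ℕ, (n - m) * treeSeries.shiftedBinom n m 0 =
      (n + 1) * treeSeries.shiftedBinom n m 1 := by
    intro m
    have := treeSeries.shiftedBinom_succ n m 0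
    push_cast at this
    linear_combination -this
  have e1 : ∀ m : ℕ, treeSeries.shiftedBinom n m 2 =
      (n - m - 1) * treeSeries.shiftedBinom n m 1 / (n + 2) := by
    intro m
    have := treeSeries.shiftedBinom_succ n m 1
    push_cast at this
    rw [eq_div_iff p2]
    linear_combination this
  have e2 : ∀ m : ℕ, treeSeries.shiftedBinom n m 3 =
      (n - m - 2) * treeSeries.shiftedBinom n m 2 / (n + 3) := by
    intro m
    have := treeSeries.shiftedBinom_succ n m 2
    push_cast at this
    rw [eq_div_iff p3]
    linear_combination this
  have e3 : ∀ m : ℕ, treeSeries.shiftedBinom n m 4 =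
      (n - m - 3) * treeSeries.shiftedBinom n m 3 / (n + 4) := by
    intro m
    have := treeSeries.shiftedBinom_succ n m 3
    push_cast at this
    rw [eq_div_iff p4]
    linear_combination this
  rw [b0, b1, b4, numPerms_eq_coeff, numPerms_eq_coeff, numPerms_eq_coeff, numPerms_eq_coeff,
    ← zero_add 1, treeSeries.coeff_openPoly_zero, zero_add, treeSeries.coeff_openPoly_one,
    treeSeries.coeff_openPoly_two, treeSeries.coeff_openPoly_two, treeSeries.coeff_open0,
    treeSeries.coeff_open1, treeSeries.coeff_open2_zero]
  refine ⟨?_, ?_, ?_, ?_⟩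
  · have h := e0 m
    field_simp
    linear_combination h
  · rw [e2, e1]
    field_simp
    ring
  · intro hm
    obtain ⟨m, rfl⟩ := Nat.exists_eq_add_of_le' hm
    have h := e0 (m + 1)
    rw [treeSeries.coeff_open2_succ, e3, e2, e1]
    push_cast at h ⊢
    field_simp
    -- The derivative term and the T^0 term combine so that index 0 carries the factor
    -- (m+2)(n-(m+1))/2, which `h` converts to index 1.
    linear_combination ((m : ℚ) + 2) * ((n : ℚ) + 2) * ((n : ℚ) + 3) * ((n : ℚ) + 4) * h
  · have h := e0 0
    rw [e3, e2, e1]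
    push_cast at h ⊢
    field_simp
    linear_combination ((n : ℚ) + 2) * ((n : ℚ) + 3) * ((n : ℚ) + 4) * h
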